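/- Fix an integer $k\ge 0$. For $\zeta\in[0,1/2)$ consider the system on $(0,\infty)$ $$u''=-e^{-2u}\bigl(4V^2+\zeta^2 (v')^2+4\zeta^2 V v'T\bigr),\qquad v''=u'(2v'+4VT)-4(k+1)V,$$ where $V(\tau)=1-\zeta^2(k+1)v(\tau)$, $T(\tau)=\tanh\tau$ and $'=d/d\tau$, for real-valued twice differentiable functions $u,v$, together with the asymptotic conditions $$u(\tau)\sim\log\tau,\quad v(\tau)\sim 2k\tau^2\quad(\tau\searrow0),\qquad u(\tau)\sim(k+1)\tau,\quad |v(\tau)|\le C e^{(k+1)(1-\epsilon)\tau}\quad(\tau\nearrow\infty),$$ the last one for some constants $C$ and $\epsilon>0$, which may depend on the solution. Here $\sim$ means that the quotient tends to $1$; the condition $v\sim 2k\tau^2$ is understood as $v(\tau)/\tau^2\to 2k$, also when $k=0$. Theorem. Let $0\le\zeta_j\nearrow\bar\zeta<1/2$ (a nondecreasing sequence with limit $\bar\zeta$), and for every $j$ let $(u_j,v_j)$ be a solution of the system with parameter $\zeta=\zeta_j$ that satisfies the asymptotic conditions. Then there are a subsequence $(u_{j'},v_{j'})$ and functions $\bar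 u,\bar v$ on $(0,\infty)$ such that $u_{j'}\to\bar u$ and $v_{j'}\to\bar v$ smoothly on compact subsets of $(0,\infty)$, that is, all these functions are smooth on $(0,\infty)$ and every derivative converges uniformly on every interval $[a,b]$ with $0<a\le b<\infty$. The limit $(\bar u,\bar v)$ solves the system with parameter $\zeta=\bar\zeta$ and satisfies the same asymptotic conditions at $0$ and at $\infty$. Moreover $\bar u$ and $\bar v$ are real analytic on $(0,\infty)$, and analyticity holds up to $\tau=0$ in the sense that $\bar u-\log\tau$ and $\bar v$ extend real-analytically to a neighborhood of $\tau=0$. -/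

import Mathlib

open Filter Topology Set Asymptotics
open scoped ContDiff

namespace KnotODE

/-- The quantity `V(τ) = 1 - ζ² (k + 1) v(τ)`. -/
noncomputable def V (k : ℕ) (ζ : ℝ) (v : ℝ → ℝ) (τ : ℝ) : ℝ :=
  1 - ζ ^ 2 * ((k : ℝ) + 1) * v τ

/-- `(u, v)` is a classical (twice differentiable) solution on `(0, ∞)` of
`u'' = -e^{-2u} (4 V² + ζ² v'² + 4 ζ² V v' T)`,
`v'' = u' (2 v' + 4 V T) - 4 (k + 1) V`, where `T(τ) = tanh τ`.
The values of `u` and `v` at `τ ≤ 0` are irrelevant. -/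
structure IsSolution (k : ℕ) (ζ : ℝ) (u v : ℝ → ℝ) : Prop where
  differentiableAt_u : ∀ τ : ℝ, 0 < τ → DifferentiableAt ℝ u τ
  differentiableAt_v : ∀ τ : ℝ, 0 < τ → DifferentiableAt ℝ v τ
  eq_u : ∀ τ : ℝ, 0 < τ →
    HasDerivAt (deriv u)
      (-Real.exp (-2 * u τ) *
        (4 * V k ζ v τ ^ 2 + ζ ^ 2 * deriv v τ ^ 2 +
          4 * ζ ^ 2 * V k ζ v τ * deriv v τ * Real.tanh τ)) τ
  eq_v : ∀ τ : ℝ, 0 < τ →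
    HasDerivAt (deriv v)
      (deriv u τ * (2 * deriv v τ + 4 * V k ζ v τ * Real.tanh τ) -
        4 * ((k : ℝ) + 1) * V k ζ v τ) τ

/-- The prescribed asymptotics:
`u ~ log τ` and `v ~ 2kτ²` as `τ ↘ 0`; `u ~ (k + 1) τ` and `|v| ≤ C e^{(k+1)(1-ε)τ}`, for some
constants `C` and `ε > 0`, as `τ ↗ ∞`. The condition on `v` at `0` is written as
`v(τ) / τ² → 2k`, which also has its intended meaning `v(τ) = o(τ²)` when `k = 0`. -/
structure HasAsymptotics (k : ℕ) (u v : ℝ → ℝ) : Prop where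
  u_zero : u ~[𝓝[>] (0 : ℝ)] Real.log
  u_top : u ~[atTop] fun τ : ℝ => ((k : ℝ) + 1) * τ
  v_zero : Tendsto (fun τ : ℝ => v τ / τ ^ 2) (𝓝[>] (0 : ℝ)) (𝓝 (2 * (k : ℝ)))
  v_top : ∃ C ε : ℝ, 0 < ε ∧
    ∀ᶠ τ : ℝ in atTop, |v τ| ≤ C * Real.exp (((k : ℝ) + 1) * (1 - ε) * τ)

/-- Smooth convergence on compact subsets of `(0, ∞)`: all functions are smooth on `(0, ∞)`, and
every derivative converges uniformly on every interval `[a, b]` with `0 < a ≤ b < ∞`. -/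
structure ConvergesSmoothly (f : ℕ → ℝ → ℝ) (g : ℝ → ℝ) : Prop where
  smooth_seq : ∀ j : ℕ, ContDiffOn ℝ ∞ (f j) (Ioi 0)
  smooth_limit : ContDiffOn ℝ ∞ g (Ioi 0)
  tendsto : ∀ (n : ℕ) (a b : ℝ), 0 < a → a ≤ b →
    TendstoUniformlyOn (fun j => iteratedDeriv n (f j)) (iteratedDeriv n g) atTop (Icc a b)

/-- Real analyticity of `(u, v)` on `(0, ∞)` and up to the singular point `τ = 0`. As
`u ~ log τ` there, the latter means that `u - log τ` and `v` extend real-analytically across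
`τ = 0`. -/
structure IsAnalyticPair (u v : ℝ → ℝ) : Prop where
  analytic_u : AnalyticOnNhd ℝ u (Ioi 0)
  analytic_v : AnalyticOnNhd ℝ v (Ioi 0)
  analytic_u_zero : ∃ w : ℝ → ℝ, AnalyticAt ℝ w 0 ∧
    ∀ᶠ τ : ℝ in 𝓝[>] (0 : ℝ), u τ = Real.log τ + w τ
  analytic_v_zero : ∃ w : ℝ → ℝ, AnalyticAt ℝ w 0 ∧
    ∀ᶠ τ : ℝ in 𝓝[>] (0 : ℝ), v τ = w τ

end KnotODE

/-!
Write `κ = k + 1`, `T = tanh τ` and `y = e^u`. Three ingredients carry the proof.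

*A priori bounds.* The bracket in the equation for `u''` is a sum of squares when `ζ < 1`, so `u` is
concave, and `u ~ κ τ` at infinity forces `u' ≥ κ` (`IsSolution.le_deriv_u`). The system conserves
`u'² + e^{-2u} (ζ² v'² - 4 V²)` (`IsSolution.hasDerivAt_energy`), and the conditions at infinity
make the constant equal to `κ²` (`IsSolution.energy_eq_sq`). Hence `ζ |v'| ≤ 2 |V|`, that is
`|V'| ≤ 2 ζ κ |V|`, which bounds `V` between `e^{± 2 ζ κ τ}`. Since `2 ζ < 1`, this is slower growth
than `e^{κ τ}`. The energy relation also gives `y' ≤ κ y + 2 |V|`, hence an upper bound for `y`; a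
differential inequality for `y'²` gives a linear lower bound at `0`; and the equation
`(e^{-2u} v')' = 4 e^{-2u} V (u' T - κ)`, integrated from infinity, bounds `v'`. All constants
depend on `k` only (`IsSolution.aprioriBounds`).

*Compactness.* With `e^{-2u}`, `u'`, `v'`, `T` and `ζ` as further unknowns the system is an autonomous
polynomial vector field (`field`). The bounds confine its trajectories to compact sets, so
convergence of the data at `τ = 1` along a subsequence and Gronwall's inequality give locally
uniform convergence (`exists_subseq_tendsto_of_hasDerivAt`), and convergence of all derivatives
follows because each derivative is a fixed smooth function on phase space. The bounds pass to the
limit (`AprioriBounds.of_tendsto`).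

*Analyticity and the behaviour at `0`.* The bounds and the energy relation show that the limit is
bounded in the regular coordinates `singularCoords`, where the singular system becomes polynomial.
The rescaled curves `t ↦ X(r t)`, `0 ≤ t ≤ 1`, are fixed points in `C([0, 1])` of an integral operator
that is polynomial in `r` and in the curve, and some iterate of which is constant at `r = 0`. By the
analytic implicit function theorem the curve depends analytically on `r`
(`exists_analyticAt_of_fixedPoint`), and evaluation at `t = 1` gives analyticity of `X` at `0`. The
same argument with `X(τ₀ + r t)` gives analyticity in the interior. The asymptotic conditions at `0`
are then read off from the regular coordinates (`AprioriBounds.hasAsymptotics`).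
-/

namespace KnotODE

/-! ### Fixed points depending analytically on a parameter -/

/-- Analytic dependence of fixed points on a parameter: if `Φ(0, ·)` is constant, then `Y - Φ(t, Y)`
has derivative `id` in `Y` at `t = 0`, and the implicit function theorem applies. -/
theorem exists_analyticAt_of_fixedPoint {B : Type*} [NormedAddCommGroup B] [NormedSpace ℝ B]
    [CompleteSpace B] {Φ : ℝ × B → B} (hΦ : ContDiff ℝ ω Φ)
    (h0 : ∀ Y Y' : B, Φ (0, Y) = Φ (0, Y')) {l : Filter ℝ} [l.NeBot] (hl : l ≤ 𝓝 0)
    {Y : ℝ → B} {Y₀ : B} (hY : Tendsto Y l (𝓝 Y₀)) (hfix : ∀ᶠ t in l, Y t = Φ (t, Y t)) :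
    ∃ g : ℝ → B, AnalyticAt ℝ g 0 ∧ ∀ᶠ t in l, Y t = g t := by
  have hpair : Tendsto (fun t => (t, Y t)) l (𝓝 ((0 : ℝ), Y₀)) :=
    (tendsto_id'.2 hl).prodMk_nhds hY
  have hY₀ : Y₀ = Φ (0, Y₀) :=
    tendsto_nhds_unique (hY.congr' hfix) ((hΦ.continuous.tendsto _).comp hpair)
  have hF : ContDiff ℝ ω (fun p : ℝ × B => p.2 - Φ p) := contDiff_snd.sub hΦ
  have hFa : ContDiffAt ℝ ω (fun p : ℝ × B => p.2 - Φ p) ((0 : ℝ), Y₀) := hF.contDiffAt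
  have hω : (ω : WithTop ℕ∞) ≠ 0 := by simp
  have hinv : (fderiv ℝ (fun p : ℝ × B => p.2 - Φ p) ((0 : ℝ), Y₀) ∘L
      .inr ℝ ℝ B).IsInvertible := by
    have h1 : HasFDerivAt ((fun p : ℝ × B => p.2 - Φ p) ∘ fun y : B => ((0 : ℝ), y))
        (fderiv ℝ (fun p : ℝ × B => p.2 - Φ p) ((0 : ℝ), Y₀) ∘L .inr ℝ ℝ B) Y₀ :=
      HasFDerivAt.comp Y₀ (hFa.differentiableAt hω).hasFDerivAt (hasFDerivAt_prodMk_right 0 Y₀)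
    have h2 : HasFDerivAt ((fun p : ℝ × B => p.2 - Φ p) ∘ fun y : B => ((0 : ℝ), y))
        (ContinuousLinearMap.id ℝ B) Y₀ := by
      have : ((fun p : ℝ × B => p.2 - Φ p) ∘ fun y : B => ((0 : ℝ), y)) =
          fun y => y - Φ (0, Y₀) := by
        funext y
        simp [h0 y Y₀]
      rw [this]
      exact (hasFDerivAt_id Y₀).sub_const _
    rw [h1.unique h2]
    exact ContinuousLinearMap.isInvertible_equiv (f := ContinuousLinearEquiv.refl ℝ B)
  refine ⟨hFa.implicitFunction hω hinv, ?_, ?_⟩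
  · exact (hFa.contDiffAt_implicitFunction hω hinv).analyticAt
  · filter_upwards [hpair.eventually (hFa.eventually_apply_eq_iff_implicitFunction hω hinv), hfix]
      with t ht hft
    refine (ht.1 ?_).symm
    simp only [sub_eq_zero.2 hft, ← hY₀, sub_self]

/-! ### Integral operators on `C([0, 1])` and rescaling -/

/-- The operator `f ↦ (t ↦ ∫₀¹ sⁿ f(s t) ds)` on `C([0, 1])`. It inverts the singular differential
operator `t d/dt + (n + 1)`. -/
noncomputable def radialMean (n : ℕ) : C(unitInterval, ℝ) →L[ℝ] C(unitInterval, ℝ) :=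
  LinearMap.mkContinuous
    { toFun := fun f => ⟨fun t => ∫ s in (0 : ℝ)..1, s ^ n * IccExtend zero_le_one f (s * t), by
        refine intervalIntegral.continuous_parametric_intervalIntegral_of_continuous'
          (f := fun (t : unitInterval) (s : ℝ) => s ^ n * IccExtend zero_le_one f (s * t)) ?_ 0 1
        have := f.continuous.Icc_extend' (h := zero_le_one)
        fun_prop⟩
      map_add' := fun f g => by
        ext t
        have hf := f.continuous.Icc_extend' (h := zero_le_one)
        have hg := g.continuous.Icc_extend' (h := zero_le_one)
        simp only [ContinuousMap.coe_mk, ContinuousMap.add_apply]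
        rw [← intervalIntegral.integral_add]
        · simp [IccExtend, mul_add]
        · exact Continuous.intervalIntegrable (by fun_prop) _ _
        · exact Continuous.intervalIntegrable (by fun_prop) _ _
      map_smul' := fun c f => by
        ext t
        simp only [ContinuousMap.coe_mk, ContinuousMap.smul_apply, smul_eq_mul, RingHom.id_apply]
        rw [← intervalIntegral.integral_const_mul]
        simp [IccExtend, mul_left_comm] } 1 (fun f => by
    rw [one_mul, ContinuousMap.norm_le _ (norm_nonneg f)]
    intro t
    have h := intervalIntegral.norm_integral_le_of_norm_le_const (a := (0 : ℝ)) (b := 1)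
      (f := fun s => s ^ n * IccExtend zero_le_one f (s * t)) (C := ‖f‖) (fun s hs => by
        rw [uIoc_of_le zero_le_one] at hs
        rw [norm_mul]
        have h1 : ‖s ^ n‖ ≤ 1 := by
          rw [Real.norm_of_nonneg (pow_nonneg hs.1.le n)]
          exact pow_le_one₀ hs.1.le hs.2
        calc _ ≤ 1 * ‖f‖ := mul_le_mul h1 (f.norm_coe_le_norm _) (norm_nonneg _) zero_le_one
          _ = ‖f‖ := one_mul _)
    simpa using h)

theorem radialMean_apply (n : ℕ) (f : C(unitInterval, ℝ)) (t : unitInterval) :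
    radialMean n f t = ∫ s in (0 : ℝ)..1, s ^ n * IccExtend zero_le_one f (s * t) := rfl

/-- The function `t ↦ X(r t)` on `[0, 1]`. -/
def rescale (X : C(ℝ, ℝ)) (r : ℝ) : C(unitInterval, ℝ) :=
  ⟨fun t => X (r * t), by fun_prop⟩

@[simp]
theorem rescale_apply (X : C(ℝ, ℝ)) (r : ℝ) (t : unitInterval) : rescale X r t = X (r * t) := rfl

theorem continuous_rescale (X : C(ℝ, ℝ)) : Continuous (rescale X) :=
  ContinuousMap.continuous_of_continuous_uncurry _
    (by simp only [Function.uncurry_def, rescale_apply]; fun_prop)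

/-- The coordinate function `t ↦ t` on `[0, 1]`. -/
def coordinate : C(unitInterval, ℝ) := ⟨fun t => t, continuous_subtype_val⟩

@[simp]
theorem coordinate_apply (t : unitInterval) : coordinate t = t := rfl

theorem radialMean_rescale (n : ℕ) (R : C(ℝ, ℝ)) (r : ℝ) (t : unitInterval) :
    radialMean n (rescale R r) t = ∫ s in (0 : ℝ)..1, s ^ n * R (s * (r * t)) := by
  rw [radialMean_apply]
  refine intervalIntegral.integral_congr fun s hs => ?_
  rw [uIcc_of_le zero_le_one] at hs
  have hst : s * (t : ℝ) ∈ Icc (0 : ℝ) 1 :=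
    ⟨mul_nonneg hs.1 t.2.1, mul_le_one₀ hs.2 t.2.1 t.2.2⟩
  simp only [IccExtend_of_mem _ _ hst, rescale_apply]
  ring_nf

/-- The integrated form of `X' = R` for the rescaled functions. -/
theorem rescale_eq_of_hasDerivAt {X R : C(ℝ, ℝ)} {r : ℝ}
    (h : ∀ τ ∈ Ioo (min 0 r) (max 0 r), HasDerivAt X (R τ) τ) :
    rescale X r = .const _ (X 0) + r • (coordinate * radialMean 0 (rescale R r)) := by
  ext t
  simp only [rescale_apply, ContinuousMap.add_apply, ContinuousMap.const_apply,
    ContinuousMap.smul_apply, ContinuousMap.mul_apply, coordinate_apply, radialMean_rescale,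
    smul_eq_mul, pow_zero, one_mul]
  rw [← mul_assoc]
  have h1 := intervalIntegral.mul_integral_comp_mul_right (f := R) (a := 0) (b := 1) (c := r * t)
  rw [h1]
  have h2 : ∫ x in (0 * (r * t : ℝ))..(1 * (r * t)), R x = X (r * t) - X 0 := by
    rw [zero_mul, one_mul]
    refine intervalIntegral.integral_eq_sub_of_hasDeriv_right X.continuous.continuousOn
      (fun τ hτ => (h τ ?_).hasDerivWithinAt) (R.continuous.intervalIntegrable _ _)
    have ht := t.2
    refine ⟨lt_of_le_of_lt ?_ hτ.1, lt_of_lt_of_le hτ.2 ?_⟩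
    · rcases le_total 0 r with hr | hr
      · rw [min_eq_left hr, min_eq_left (mul_nonneg hr ht.1)]
      · rw [min_eq_right hr]
        exact le_min hr (by nlinarith [ht.1, ht.2])
    · rcases le_total 0 r with hr | hr
      · rw [max_eq_right hr]
        exact max_le hr (by nlinarith [ht.1, ht.2])
      · rw [max_eq_left hr]
        exact max_le le_rfl (mul_nonpos_of_nonpos_of_nonneg hr ht.1)
  rw [h2]
  ring

/-- The integrated form of `τ X' + (n + 1) X = R` for the rescaled functions. -/
theorem rescale_eq_of_hasDerivAt_pow_mul {X R : C(ℝ, ℝ)} {n : ℕ} {r : ℝ} (hr : 0 < r)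
    (h : ∀ τ ∈ Ioo 0 r, HasDerivAt (fun τ => τ ^ (n + 1) * X τ) (τ ^ n * R τ) τ) :
    rescale X r = radialMean n (rescale R r) := by
  have key : ∀ τ ∈ Ioc 0 r, X τ = ∫ s in (0 : ℝ)..1, s ^ n * R (s * τ) := by
    intro τ hτ
    have h2 : ∫ x in (0 : ℝ)..τ, x ^ n * R x = τ ^ (n + 1) * X τ - 0 ^ (n + 1) * X 0 := by
      refine intervalIntegral.integral_eq_sub_of_hasDeriv_right (by fun_prop)
        (f := fun τ => τ ^ (n + 1) * X τ)
        (fun σ hσ => (h σ ?_).hasDerivWithinAt) (Continuous.intervalIntegrable (by fun_prop) _ _)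
      rw [min_eq_left hτ.1.le, max_eq_right hτ.1.le] at hσ
      exact ⟨hσ.1, hσ.2.trans_le hτ.2⟩
    have h1 := intervalIntegral.mul_integral_comp_mul_right (f := fun x => x ^ n * R x)
      (a := 0) (b := 1) (c := τ)
    simp only [mul_pow, zero_mul, one_mul] at h1
    rw [h2, zero_pow (by omega), zero_mul, sub_zero, pow_succ] at h1
    have h3 : (∫ x in (0 : ℝ)..1, x ^ n * τ ^ n * R (x * τ)) =
        τ ^ n * ∫ x in (0 : ℝ)..1, x ^ n * R (x * τ) := by
      rw [← intervalIntegral.integral_const_mul]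
      congr 1
      funext x
      ring
    rw [h3] at h1
    have hτ0 : τ ^ n * τ ≠ 0 := (mul_pos (pow_pos hτ.1 n) hτ.1).ne'
    apply mul_left_cancel₀ hτ0
    rw [← h1]
    ring
  have hfun : ∀ τ ∈ Icc 0 r, X τ = ∫ s in (0 : ℝ)..1, s ^ n * R (s * τ) := by
    have hc : Continuous fun τ : ℝ => ∫ s in (0 : ℝ)..1, s ^ n * R (s * τ) :=
      intervalIntegral.continuous_parametric_intervalIntegral_of_continuous'
        (f := fun (τ s : ℝ) => s ^ n * R (s * τ)) (by fun_prop) 0 1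
    have := EqOn.closure (s := Ioc 0 r) key X.continuous hc
    rwa [closure_Ioc hr.ne] at this
  ext t
  rw [radialMean_rescale]
  exact hfun _ ⟨mul_nonneg hr.le t.2.1, mul_le_of_le_one_right hr.le t.2.2⟩

/-! ### Compactness for autonomous ordinary differential equations -/

section Compactness

variable {E : Type*} [NormedAddCommGroup E] [NormedSpace ℝ E]

/-- Uniform convergence on a compact set to a continuous limit is preserved by composition with a
continuous function, which need not be uniformly continuous. -/
theorem tendstoUniformlyOn_comp [FiniteDimensional ℝ E] {G : Type*} [NormedAddCommGroup G]
    {X : ℕ → ℝ → E} {Y : ℝ → E} {K : Set ℝ} (hK : IsCompact K) (hY : ContinuousOn Y K)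
    (h : TendstoUniformlyOn X Y atTop K) {g : E → G} (hg : Continuous g) :
    TendstoUniformlyOn (fun j τ => g (X j τ)) (fun τ => g (Y τ)) atTop K := by
  have : ProperSpace E := FiniteDimensional.proper ℝ E
  have hc : IsCompact (Metric.cthickening 1 (Y '' K)) := (hK.image_of_continuousOn hY).cthickening
  have hu := hc.uniformContinuousOn_of_continuous hg.continuousOn
  refine hu.comp_tendstoUniformlyOn_eventually ?_ ?_ h
  · filter_upwards [Metric.tendstoUniformlyOn_iff.1 h 1 one_pos] with j hj τ hτ
    exact Metric.mem_cthickening_of_dist_le _ (Y τ) _ _ (mem_image_of_mem _ hτ)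
      (by rw [dist_comm]; exact (hj τ hτ).le)
  · intro τ hτ
    exact Metric.self_subset_cthickening _ (mem_image_of_mem _ hτ)

/-- Gronwall's inequality, forward and backward in time, on a ball where the field is Lipschitz. -/
theorem dist_le_of_hasDerivAt {f : E → E} {L : NNReal} {S : Set E} (hf : LipschitzOnWith L f S)
    {X Y : ℝ → E} {a b c : ℝ} (hc : c ∈ Icc a b)
    (hX : ∀ τ ∈ Icc a b, HasDerivAt X (f (X τ)) τ) (hY : ∀ τ ∈ Icc a b, HasDerivAt Y (f (Y τ)) τ)
    (hXS : ∀ τ ∈ Icc a b, X τ ∈ S) (hYS : ∀ τ ∈ Icc a b, Y τ ∈ S) :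
    ∀ τ ∈ Icc a b, dist (X τ) (Y τ) ≤ dist (X c) (Y c) * Real.exp (L * (b - a)) := by
  intro τ hτ
  rcases le_total c τ with h | h
  · have hsub : Icc c τ ⊆ Icc a b := Icc_subset_Icc hc.1 hτ.2
    have hsub' : Ico c τ ⊆ Icc a b := Ico_subset_Icc_self.trans hsub
    refine (dist_le_of_trajectories_ODE_of_mem (v := fun _ => f) (s := fun _ => S)
      (fun t _ => hf)
      (fun t ht => (hX t (hsub ht)).continuousAt.continuousWithinAt)
      (fun t ht => (hX t (hsub' ht)).hasDerivWithinAt) (fun t ht => hXS t (hsub' ht))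
      (fun t ht => (hY t (hsub ht)).continuousAt.continuousWithinAt)
      (fun t ht => (hY t (hsub' ht)).hasDerivWithinAt) (fun t ht => hYS t (hsub' ht))
      le_rfl τ ⟨h, le_rfl⟩).trans ?_
    gcongr
    · exact hτ.2
    · exact hc.1
  · -- the time reversal of a solution solves the equation with the opposite field
    have hsub : ∀ t ∈ Icc (-c) (-τ), -t ∈ Icc a b := fun t ht =>
      ⟨by linarith [ht.2, hτ.1], by linarith [ht.1, hc.2]⟩
    have hrev : ∀ {Z : ℝ → E}, (∀ τ ∈ Icc a b, HasDerivAt Z (f (Z τ)) τ) →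
        ∀ t ∈ Icc (-c) (-τ), HasDerivAt (fun t => Z (-t)) (-f (Z (-t))) t := by
      intro Z hZ t ht
      have := (hZ _ (hsub t ht)).scomp t (hasDerivAt_neg t)
      simpa [Function.comp_def] using this
    have hneg : LipschitzOnWith L (fun x => -f x) S := hf.neg
    have := dist_le_of_trajectories_ODE_of_mem (v := fun _ x => -f x) (s := fun _ => S)
      (f := fun t => X (-t)) (g := fun t => Y (-t)) (a := -c) (b := -τ)
      (fun t _ => hneg)
      (fun t ht => (hrev hX t ht).continuousAt.continuousWithinAt)
      (fun t ht => (hrev hX t (Ico_subset_Icc_self ht)).hasDerivWithinAt)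
      (fun t ht => hXS _ (hsub t (Ico_subset_Icc_self ht)))
      (fun t ht => (hrev hY t ht).continuousAt.continuousWithinAt)
      (fun t ht => (hrev hY t (Ico_subset_Icc_self ht)).hasDerivWithinAt)
      (fun t ht => hYS _ (hsub t (Ico_subset_Icc_self ht)))
      le_rfl (-τ) ⟨by linarith, le_rfl⟩
    simp only [neg_neg] at this
    refine this.trans (mul_le_mul_of_nonneg_left (Real.exp_le_exp.2
      (mul_le_mul_of_nonneg_left ?_ L.coe_nonneg)) dist_nonneg)
    linarith [hτ.1, hc.2]

/-- Solutions of an autonomous equation on `(0, ∞)` that are uniformly bounded on compact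
subintervals subconverge, uniformly on compact subintervals, to a solution. -/
theorem exists_subseq_tendsto_of_hasDerivAt [FiniteDimensional ℝ E] {f : E → E} (hf : ContDiff ℝ 1 f) {X : ℕ → ℝ → E}
    (hX : ∀ j τ, 0 < τ → HasDerivAt (X j) (f (X j τ)) τ)
    (hbd : ∀ a b : ℝ, 0 < a → a ≤ b → ∃ R, ∀ j, ∀ τ ∈ Icc a b, ‖X j τ‖ ≤ R) :
    ∃ (φ : ℕ → ℕ) (Y : ℝ → E), StrictMono φ ∧
      (∀ a b : ℝ, 0 < a → TendstoUniformlyOn (fun j => X (φ j)) Y atTop (Icc a b)) ∧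
      ∀ τ, 0 < τ → HasDerivAt Y (f (Y τ)) τ := by
  have : ProperSpace E := FiniteDimensional.proper ℝ E
  obtain ⟨R₁, hR₁⟩ := hbd 1 1 one_pos le_rfl
  obtain ⟨x, -, φ, hφ, hx⟩ := tendsto_subseq_of_bounded (x := fun j => X j 1)
    (Metric.isBounded_closedBall (x := (0 : E)) (r := R₁))
    (fun j => by simpa using hR₁ j 1 ⟨le_rfl, le_rfl⟩)
  have hcauchy : ∀ a b : ℝ, 0 < a → ∃ C : ℝ, 0 < C ∧ ∀ i j, ∀ τ ∈ Icc a b,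
      dist (X (φ i) τ) (X (φ j) τ) ≤ dist (X (φ i) 1) (X (φ j) 1) * C := by
    intro a b ha
    have ha' : 0 < min a 1 := lt_min ha one_pos
    obtain ⟨R, hR⟩ := hbd (min a 1) (max b 1) ha' ((min_le_right _ _).trans (le_max_right _ _))
    obtain ⟨L, hL⟩ := (isCompact_closedBall (0 : E) R).exists_bound_of_continuousOn
      (hf.continuous_fderiv one_ne_zero).continuousOn
    have hlip : LipschitzOnWith L.toNNReal f (Metric.closedBall 0 R) :=
      (convex_closedBall (0 : E) R).lipschitzOnWith_of_nnnorm_fderiv_le (𝕜 := ℝ)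
        (fun y _ => hf.differentiable one_ne_zero y) (fun y hy => by
          rw [← NNReal.coe_le_coe, coe_nnnorm]
          exact (hL y hy).trans (Real.le_coe_toNNReal L))
    refine ⟨_, Real.exp_pos (L.toNNReal * (max b 1 - min a 1)), fun i j τ hτ => ?_⟩
    have hmem : ∀ i, ∀ τ ∈ Icc (min a 1) (max b 1), X (φ i) τ ∈ Metric.closedBall 0 R :=
      fun i τ hτ => by simpa using hR (φ i) τ hτ
    exact dist_le_of_hasDerivAt hlip ⟨min_le_right _ _, le_max_right _ _⟩
      (fun τ hτ => hX _ τ (ha'.trans_le hτ.1)) (fun τ hτ => hX _ τ (ha'.trans_le hτ.1))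
      (hmem i) (hmem j) τ (Icc_subset_Icc (min_le_left _ _) (le_max_left _ _) hτ)
  have hunif : ∀ a b : ℝ, 0 < a → UniformCauchySeqOn (fun j => X (φ j)) atTop (Icc a b) := by
    intro a b ha
    obtain ⟨C, hC, h⟩ := hcauchy a b ha
    rw [Metric.uniformCauchySeqOn_iff]
    intro ε hε
    obtain ⟨N, hN⟩ := Metric.cauchySeq_iff.1 hx.cauchySeq (ε / C) (div_pos hε hC)
    refine ⟨N, fun m hm n hn τ hτ => (h m n τ hτ).trans_lt ?_⟩
    rw [← lt_div_iff₀ hC]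
    exact hN m hm n hn
  have hpt : ∀ τ, ∃ y, 0 < τ → Tendsto (fun j => X (φ j) τ) atTop (𝓝 y) := by
    intro τ
    by_cases hτ : 0 < τ
    · obtain ⟨y, hy⟩ := cauchySeq_tendsto_of_complete
        ((hunif τ τ hτ).cauchySeq ⟨le_rfl, le_rfl⟩)
      exact ⟨y, fun _ => hy⟩
    · exact ⟨0, fun h => absurd h hτ⟩
  choose Y hY using hpt
  have hconv : ∀ a b : ℝ, 0 < a → TendstoUniformlyOn (fun j => X (φ j)) Y atTop (Icc a b) :=
    fun a b ha => (hunif a b ha).tendstoUniformlyOn_of_tendsto fun τ hτ => hY τ (ha.trans_le hτ.1)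
  refine ⟨φ, Y, hφ, hconv, fun τ hτ => ?_⟩
  have hpos : 0 < τ / 2 := half_pos hτ
  have hcont : ContinuousOn Y (Icc (τ / 2) (2 * τ)) :=
    (hconv _ _ hpos).continuousOn (Frequently.of_forall fun j σ hσ =>
      (hX (φ j) σ (hpos.trans_le hσ.1)).continuousAt.continuousWithinAt)
  have hder := tendstoUniformlyOn_comp isCompact_Icc hcont (hconv _ _ hpos)
    hf.continuous
  refine hasDerivAt_of_tendstoUniformlyOn (s := Ioo (τ / 2) (2 * τ)) isOpen_Ioo
    (hder.mono Ioo_subset_Icc_self)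
    (Eventually.of_forall fun j σ hσ => hX (φ j) σ (hpos.trans hσ.1))
    (fun σ hσ => hY σ (hpos.trans hσ.1)) ⟨by linarith, by linarith⟩

/-- The derivative of a function on phase space along the vector field `f`. -/
noncomputable def lieDerivative (f : E → E) (g : E → ℝ) : E → ℝ := fun x => fderiv ℝ g x (f x)

theorem contDiff_iterate_lieDerivative {f : E → E} (hf : ContDiff ℝ ∞ f) {g : E → ℝ}
    (hg : ContDiff ℝ ∞ g) (n : ℕ) : ContDiff ℝ ∞ ((lieDerivative f)^[n] g) := by
  induction n with
  | zero => exact hg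
  | succ n ih =>
    rw [Function.iterate_succ_apply']
    exact (ih.fderiv_right (m := ∞) (by simp)).clm_apply hf

/-- Along a solution, the `n`-th derivative of an observable is its `n`-th Lie derivative. -/
theorem iteratedDeriv_comp_eq {f : E → E} (hf : ContDiff ℝ ∞ f) {g : E → ℝ}
    (hg : ContDiff ℝ ∞ g) {X : ℝ → E} (hX : ∀ τ, 0 < τ → HasDerivAt X (f (X τ)) τ) (n : ℕ) :
    ∀ τ, 0 < τ → iteratedDeriv n (fun τ => g (X τ)) τ = (lieDerivative f)^[n] g (X τ) := by
  induction n with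
  | zero => simp
  | succ n ih =>
    intro τ hτ
    rw [iteratedDeriv_succ, Function.iterate_succ_apply']
    have hev : iteratedDeriv n (fun τ => g (X τ)) =ᶠ[𝓝 τ]
        fun τ => (lieDerivative f)^[n] g (X τ) := by
      filter_upwards [Ioi_mem_nhds hτ] with σ hσ using ih σ hσ
    rw [hev.deriv_eq]
    have hd := ((contDiff_iterate_lieDerivative hf hg n).differentiable (by simp)
      (X τ)).hasFDerivAt
    exact (hd.comp_hasDerivAt τ (hX τ hτ)).deriv

/-- For solutions of an autonomous equation with a smooth field, locally uniform convergence
implies convergence of all derivatives. -/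
theorem convergesSmoothly_comp [FiniteDimensional ℝ E] {f : E → E} (hf : ContDiff ℝ ∞ f) {g : E → ℝ}
    (hg : ContDiff ℝ ∞ g) {X : ℕ → ℝ → E} {Y : ℝ → E}
    (hX : ∀ j τ, 0 < τ → HasDerivAt (X j) (f (X j τ)) τ)
    (hY : ∀ τ, 0 < τ → HasDerivAt Y (f (Y τ)) τ)
    (hXs : ∀ j, ContDiffOn ℝ ∞ (X j) (Ioi 0)) (hYs : ContDiffOn ℝ ∞ Y (Ioi 0))
    (hconv : ∀ a b : ℝ, 0 < a → TendstoUniformlyOn X Y atTop (Icc a b)) :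
    ConvergesSmoothly (fun j τ => g (X j τ)) (fun τ => g (Y τ)) where
  smooth_seq j := hg.comp_contDiffOn (hXs j)
  smooth_limit := hg.comp_contDiffOn hYs
  tendsto n a b ha _ := by
    have h := tendstoUniformlyOn_comp isCompact_Icc
      (fun τ hτ => (hY τ (ha.trans_le hτ.1)).continuousAt.continuousWithinAt) (hconv a b ha)
      (contDiff_iterate_lieDerivative hf hg n).continuous
    refine (h.congr (Eventually.of_forall fun j τ hτ => ?_)).congr_right fun τ hτ => ?_
    · exact (iteratedDeriv_comp_eq hf hg (hX j) n τ (ha.trans_le hτ.1)).symm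
    · exact (iteratedDeriv_comp_eq hf hg hY n τ (ha.trans_le hτ.1)).symm

end Compactness

/-! ### The polynomial system and interior analyticity -/

/-- The system as an autonomous polynomial vector field. The state is
`(u, e^{-2u}, u', v, v', tanh τ, ζ)`. The entries are taken in any commutative ring, so that the
field applies to numbers and to continuous functions alike. -/
def field (k : ℕ) {A : Type*} [CommRing A] (x : Fin 7 → A) : Fin 7 → A :=
  ![x 2,
    -2 * x 2 * x 1,
    -x 1 * (4 * (1 - x 6 ^ 2 * (k + 1) * x 3) ^ 2 + x 6 ^ 2 * x 4 ^ 2 +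
      4 * x 6 ^ 2 * (1 - x 6 ^ 2 * (k + 1) * x 3) * x 4 * x 5),
    x 4,
    x 2 * (2 * x 4 + 4 * (1 - x 6 ^ 2 * (k + 1) * x 3) * x 5) -
      4 * (k + 1) * (1 - x 6 ^ 2 * (k + 1) * x 3),
    1 - x 5 ^ 2,
    0]

theorem map_field (k : ℕ) {A B : Type*} [CommRing A] [CommRing B] (f : A →+* B) (x : Fin 7 → A)
    (i : Fin 7) : f (field k x i) = field k (fun j => f (x j)) i := by
  have h2 : f 2 = 2 := map_ofNat f 2
  have h4 : f 4 = 4 := map_ofNat f 4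
  fin_cases i <;> simp [field, h2, h4]

theorem contDiff_field (k : ℕ) {A : Type*} [NormedCommRing A] [NormedAlgebra ℝ A]
    {n : WithTop ℕ∞} : ContDiff ℝ n (field k : (Fin 7 → A) → Fin 7 → A) := by
  rw [contDiff_pi]
  intro i
  fin_cases i <;> simp only [field] <;> simp <;> fun_prop

/-- Extension of a continuous function on `[a, b]` to the line, by constants. -/
theorem exists_continuousMap_eqOn {x : ℝ → ℝ} {a b : ℝ} (hab : a ≤ b)
    (hx : ContinuousOn x (Icc a b)) : ∃ X : C(ℝ, ℝ), ∀ t ∈ Icc a b, X t = x t :=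
  ⟨⟨IccExtend hab ((Icc a b).domRestrict x), hx.domRestrict.Icc_extend'⟩,
    fun _ ht => IccExtend_of_mem hab ((Icc a b).domRestrict x) ht⟩

/-- The solutions of the polynomial system are real analytic: the rescaled curves
`t ↦ X (τ₀ + r t)` are fixed points in `C([0, 1])` of an integral operator that depends
analytically on `r`. -/
theorem analyticAt_of_hasDerivAt_field {k : ℕ} {X : ℝ → Fin 7 → ℝ} {τ₀ : ℝ}
    (hX : ∀ᶠ τ in 𝓝 τ₀, HasDerivAt X (field k (X τ)) τ) : AnalyticAt ℝ X τ₀ := by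
  obtain ⟨ε, hε, hball⟩ := Metric.eventually_nhds_iff_ball.1 hX
  have hδ : 0 < ε / 2 := half_pos hε
  set δ := ε / 2 with hδ_def
  have hmem : ∀ s ∈ Icc (-δ) δ, HasDerivAt X (field k (X (τ₀ + s))) (τ₀ + s) := by
    intro s hs
    refine hball _ ?_
    rw [Metric.mem_ball, Real.dist_eq, add_sub_cancel_left]
    exact (abs_le.2 hs).trans_lt (half_lt_self hε)
  have hcont : ∀ i, ContinuousOn (fun s => X (τ₀ + s) i) (Icc (-δ) δ) := by
    intro i s hs
    have h1 : ContinuousAt X (τ₀ + s) := (hmem s hs).continuousAt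
    have h2 : ContinuousAt (fun s => X (τ₀ + s)) s :=
      ContinuousAt.comp (f := fun s => τ₀ + s) h1 (by fun_prop)
    exact (continuousAt_pi.1 h2 i).continuousWithinAt
  choose Z hZ using fun i => exists_continuousMap_eqOn (by linarith) (hcont i)
  let Φ : ℝ × (Fin 7 → C(unitInterval, ℝ)) → Fin 7 → C(unitInterval, ℝ) := fun p i =>
    .const _ (X τ₀ i) + p.1 • (coordinate * radialMean 0 (field k p.2 i))
  have hΦ : ContDiff ℝ ω Φ := by
    rw [contDiff_pi]
    intro i
    have h1 : ContDiff ℝ ω fun p : ℝ × (Fin 7 → C(unitInterval, ℝ)) => field k p.2 i :=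
      (contDiff_pi.1 (contDiff_field k) i).comp contDiff_snd
    have h2 := (radialMean 0).contDiff.comp h1
    exact contDiff_const.add (contDiff_fst.smul (contDiff_const.mul h2))
  have hZ0 : ∀ i, Z i 0 = X τ₀ i := fun i => by
    rw [hZ i 0 ⟨by linarith, hδ.le⟩, add_zero]
  have hfix : ∀ᶠ r in 𝓝 (0 : ℝ), (fun i => rescale (Z i) r) = Φ (r, fun i => rescale (Z i) r) := by
    filter_upwards [Icc_mem_nhds (neg_lt_zero.2 hδ) hδ] with r hr
    funext i
    have hres : field k (fun i => rescale (Z i) r) i = rescale (field k Z i) r := by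
      ext t
      rw [rescale_apply]
      have h1 := map_field k (ContinuousMap.evalAlgHom ℝ ℝ t).toRingHom
        (fun i => rescale (Z i) r) i
      have h2 := map_field k (ContinuousMap.evalAlgHom ℝ ℝ (r * t : ℝ)).toRingHom Z i
      exact h1.trans h2.symm
    simp only [Φ]
    rw [hres, ← hZ0 i]
    refine rescale_eq_of_hasDerivAt fun s hs => ?_
    have hs' : s ∈ Ioo (-δ) δ := by
      refine ⟨lt_of_le_of_lt (le_min (neg_nonpos.2 hδ.le) hr.1) hs.1,
        lt_of_lt_of_le hs.2 (max_le hδ.le hr.2)⟩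
    have h1 : HasDerivAt (fun s => X (τ₀ + s) i) (field k (X (τ₀ + s)) i) s := by
      have := hasDerivAt_pi.1 (hmem s (Ioo_subset_Icc_self hs')) i
      simpa using this.comp_const_add τ₀ s
    have h2 : field k Z i s = field k (X (τ₀ + s)) i := by
      have h2 := map_field k (ContinuousMap.evalAlgHom ℝ ℝ s).toRingHom Z i
      refine h2.trans ?_
      congr 1
      funext j
      exact hZ j s (Ioo_subset_Icc_self hs')
    rw [h2]
    refine h1.congr_of_eventuallyEq ?_
    filter_upwards [Ioo_mem_nhds hs'.1 hs'.2] with σ hσ using hZ i σ (Ioo_subset_Icc_self hσ)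
  obtain ⟨g, hg, hgY⟩ := exists_analyticAt_of_fixedPoint hΦ (fun Y Y' => by simp [Φ]) le_rfl
    ((continuous_pi fun i => continuous_rescale (Z i)).tendsto 0) hfix
  rw [analyticAt_pi_iff]
  intro i
  have hev : (fun τ => X τ i) =ᶠ[𝓝 τ₀] fun τ => ContinuousMap.evalCLM ℝ 1 (g (τ - τ₀) i) := by
    have ht : Tendsto (fun τ => τ - τ₀) (𝓝 τ₀) (𝓝 0) := by
      have : ContinuousAt (fun τ => τ - τ₀) τ₀ := by fun_prop
      simpa [ContinuousAt] using this
    filter_upwards [ht.eventually hgY, ht.eventually (Icc_mem_nhds (neg_lt_zero.2 hδ) hδ)]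
      with τ hτ hτ'
    rw [← hτ]
    change _ = Z i ((τ - τ₀) * (1 : unitInterval))
    rw [Set.Icc.coe_one, mul_one, hZ i _ hτ']
    simp
  refine AnalyticAt.congr ?_ hev.symm
  have hgi : AnalyticAt ℝ (fun r => g r i) 0 := analyticAt_pi_iff.1 hg i
  have hsub : AnalyticAt ℝ (fun τ : ℝ => τ - τ₀) τ₀ := analyticAt_id.sub analyticAt_const
  have hcomp : AnalyticAt ℝ (fun τ => g (τ - τ₀) i) τ₀ :=
    AnalyticAt.comp (g := fun r => g r i) (by simpa using hgi) hsub
  exact (ContinuousLinearMap.analyticAt _ _).comp hcomp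

theorem contDiffOn_of_hasDerivAt_field {k : ℕ} {X : ℝ → Fin 7 → ℝ}
    (hX : ∀ τ, 0 < τ → HasDerivAt X (field k (X τ)) τ) : ContDiffOn ℝ ∞ X (Ioi 0) :=
  fun _ hτ => (analyticAt_of_hasDerivAt_field
    (eventually_of_mem (Ioi_mem_nhds hτ) hX)).contDiffAt.contDiffWithinAt

/-! ### Monotonicity, limits and the hyperbolic tangent -/

theorem hasDerivAt_tanh (τ : ℝ) : HasDerivAt Real.tanh (1 - Real.tanh τ ^ 2) τ := by
  have hc := (Real.cosh_pos τ).ne'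
  have h := (Real.hasDerivAt_sinh τ).div (Real.hasDerivAt_cosh τ) hc
  have he : (fun x => Real.sinh x / Real.cosh x) = Real.tanh := by
    funext x
    rw [Real.tanh_eq_sinh_div_cosh]
  change HasDerivAt (fun x => Real.sinh x / Real.cosh x) _ _ at h
  rw [he] at h
  convert h using 1
  rw [Real.tanh_eq_sinh_div_cosh]
  field_simp

theorem tanh_nonneg_of_nonneg {τ : ℝ} (hτ : 0 ≤ τ) : 0 ≤ Real.tanh τ := by
  rw [Real.tanh_eq_sinh_div_cosh]
  exact div_nonneg (Real.sinh_nonneg_iff.2 hτ) (Real.cosh_pos τ).le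

theorem monotoneOn_of_hasDerivAt_nonneg {s : Set ℝ} (hs : Convex ℝ s) {f f' : ℝ → ℝ}
    (h : ∀ x ∈ s, HasDerivAt f (f' x) x) (h' : ∀ x ∈ s, 0 ≤ f' x) : MonotoneOn f s :=
  monotoneOn_of_deriv_nonneg hs (fun x hx => (h x hx).continuousAt.continuousWithinAt)
    (fun x hx => (h x (interior_subset hx)).differentiableAt.differentiableWithinAt)
    (fun x hx => by rw [(h x (interior_subset hx)).deriv]; exact h' x (interior_subset hx))

theorem antitoneOn_of_hasDerivAt_nonpos {s : Set ℝ} (hs : Convex ℝ s) {f f' : ℝ → ℝ}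
    (h : ∀ x ∈ s, HasDerivAt f (f' x) x) (h' : ∀ x ∈ s, f' x ≤ 0) : AntitoneOn f s :=
  antitoneOn_of_deriv_nonpos hs (fun x hx => (h x hx).continuousAt.continuousWithinAt)
    (fun x hx => (h x (interior_subset hx)).differentiableAt.differentiableWithinAt)
    (fun x hx => by rw [(h x (interior_subset hx)).deriv]; exact h' x (interior_subset hx))

/-- A function on `(0, b)` with nonnegative derivative is bounded below by its limit at `0`. -/
theorem le_of_tendsto_of_hasDerivAt_nonneg {b c L : ℝ} {f f' : ℝ → ℝ}
    (h : ∀ x ∈ Ioo 0 b, HasDerivAt f (f' x) x) (h' : ∀ x ∈ Ioo 0 b, 0 ≤ f' x)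
    (hL : Tendsto f (𝓝[>] 0) (𝓝 L)) (hc : c ∈ Ioo 0 b) : L ≤ f c :=
  le_of_tendsto hL (by
    filter_upwards [Ioo_mem_nhdsGT hc.1] with x hx
    exact monotoneOn_of_hasDerivAt_nonneg (convex_Ioo 0 b) h h' ⟨hx.1, hx.2.trans hc.2⟩ hc hx.2.le)

/-- If `|f'| ≤ b'` on `(0, c)` and `f` and `b` vanish at `0`, then `|f| ≤ b`. -/
theorem abs_le_of_abs_hasDerivAt_le {c : ℝ} {f f' b b' : ℝ → ℝ}
    (hf : ∀ x ∈ Ioo 0 c, HasDerivAt f (f' x) x) (hb : ∀ x ∈ Ioo 0 c, HasDerivAt b (b' x) x)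
    (h : ∀ x ∈ Ioo 0 c, |f' x| ≤ b' x) (hf0 : Tendsto f (𝓝[>] 0) (𝓝 0))
    (hb0 : Tendsto b (𝓝[>] 0) (𝓝 0)) : ∀ x ∈ Ioo 0 c, |f x| ≤ b x := by
  intro x hx
  have h1 := le_of_tendsto_of_hasDerivAt_nonneg (fun x hx => (hb x hx).sub (hf x hx))
    (fun x hx => by linarith [(abs_le.1 (h x hx)).2]) (L := 0) (by have := hb0.sub hf0; rwa [sub_zero] at this) hx
  have h2 := le_of_tendsto_of_hasDerivAt_nonneg (fun x hx => (hb x hx).add (hf x hx))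
    (fun x hx => by linarith [(abs_le.1 (h x hx)).1]) (L := 0) (by have := hb0.add hf0; rwa [add_zero] at this) hx
  simp only [Pi.sub_apply, Pi.add_apply] at h1 h2
  exact abs_le.2 ⟨by linarith, by linarith⟩

theorem tanh_le_one {τ : ℝ} : Real.tanh τ ≤ 1 := (Real.tanh_lt_one τ).le

theorem tanh_le_self {τ : ℝ} (hτ : 0 ≤ τ) : Real.tanh τ ≤ τ := by
  have h : MonotoneOn (fun x => x - Real.tanh x) (Ici 0) :=
    monotoneOn_of_hasDerivAt_nonneg (convex_Ici 0)
      (fun x _ => (hasDerivAt_id x).sub (hasDerivAt_tanh x))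
      (fun x _ => by nlinarith [sq_nonneg (Real.tanh x)])
  have := h (mem_Ici.2 le_rfl) (mem_Ici.2 hτ) hτ
  simp only [sub_self, Real.tanh_zero] at this
  linarith

/-! ### The conserved energy -/

/-- The conserved quantity `u'² + e^{-2u} (ζ² v'² - 4 V²)` of the system. -/
noncomputable def energy (k : ℕ) (ζ : ℝ) (u v : ℝ → ℝ) (τ : ℝ) : ℝ :=
  deriv u τ ^ 2 + Real.exp (-2 * u τ) * (ζ ^ 2 * deriv v τ ^ 2 - 4 * V k ζ v τ ^ 2)

section Solution

variable {k : ℕ} {ζ : ℝ} {u v : ℝ → ℝ}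

theorem IsSolution.hasDerivAt_u (h : IsSolution k ζ u v) {τ : ℝ} (hτ : 0 < τ) :
    HasDerivAt u (deriv u τ) τ := (h.differentiableAt_u τ hτ).hasDerivAt

theorem IsSolution.hasDerivAt_v (h : IsSolution k ζ u v) {τ : ℝ} (hτ : 0 < τ) :
    HasDerivAt v (deriv v τ) τ := (h.differentiableAt_v τ hτ).hasDerivAt

theorem IsSolution.hasDerivAt_V (h : IsSolution k ζ u v) {τ : ℝ} (hτ : 0 < τ) :
    HasDerivAt (V k ζ v) (-(ζ ^ 2 * ((k : ℝ) + 1) * deriv v τ)) τ := by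
  unfold V
  exact ((h.hasDerivAt_v hτ).const_mul _).const_sub 1

theorem IsSolution.hasDerivAt_exp_u (h : IsSolution k ζ u v) {τ : ℝ} (hτ : 0 < τ) :
    HasDerivAt (fun τ => Real.exp (u τ)) (Real.exp (u τ) * deriv u τ) τ :=
  (h.hasDerivAt_u hτ).exp

theorem IsSolution.hasDerivAt_exp_neg_two_u (h : IsSolution k ζ u v) {τ : ℝ} (hτ : 0 < τ) :
    HasDerivAt (fun τ => Real.exp (-2 * u τ)) (Real.exp (-2 * u τ) * (-2 * deriv u τ)) τ :=
  ((h.hasDerivAt_u hτ).const_mul (-2)).exp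

theorem IsSolution.hasDerivAt_energy (h : IsSolution k ζ u v) {τ : ℝ} (hτ : 0 < τ) :
    HasDerivAt (energy k ζ u v) 0 τ := by
  have h1 := ((h.eq_u τ hτ).pow 2).add ((h.hasDerivAt_exp_neg_two_u hτ).mul
    ((((h.eq_v τ hτ).pow 2).const_mul (ζ ^ 2)).sub (((h.hasDerivAt_V hτ).pow 2).const_mul 4)))
  refine (h1.congr_deriv ?_)
  simp only [Pi.pow_apply, Pi.sub_apply]
  ring

theorem IsSolution.energy_eq (h : IsSolution k ζ u v) {σ τ : ℝ} (hσ : 0 < σ) (hτ : 0 < τ) :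
    energy k ζ u v σ = energy k ζ u v τ :=
  isOpen_Ioi.is_const_of_deriv_eq_zero (s := Ioi (0 : ℝ)) (convex_Ioi (0 : ℝ)).isPreconnected
    (fun _ hx => (h.hasDerivAt_energy hx).differentiableAt.differentiableWithinAt)
    (fun _ hx => (h.hasDerivAt_energy hx).deriv) hσ hτ

/-- The bracket in the equation for `u''`, which equals
`ζ² (v' + 2 V tanh τ)² + 4 V² (1 - ζ² tanh² τ)`, dominates `V²`. -/
theorem sq_V_le_source (hζ : 0 ≤ ζ) (hζ' : ζ < 1 / 2) (τ : ℝ) :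
    V k ζ v τ ^ 2 ≤ 4 * V k ζ v τ ^ 2 + ζ ^ 2 * deriv v τ ^ 2 +
      4 * ζ ^ 2 * V k ζ v τ * deriv v τ * Real.tanh τ := by
  have hT : Real.tanh τ ^ 2 ≤ 1 := (Real.tanh_sq_lt_one τ).le
  have hζ2 : ζ ^ 2 ≤ 1 / 4 := by nlinarith
  have h1 : ζ ^ 2 * Real.tanh τ ^ 2 ≤ 1 / 4 := by nlinarith [sq_nonneg (Real.tanh τ)]
  nlinarith [sq_nonneg (ζ * (deriv v τ + 2 * V k ζ v τ * Real.tanh τ)), sq_nonneg (V k ζ v τ)]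

theorem IsSolution.antitoneOn_deriv_u (h : IsSolution k ζ u v) (hζ : 0 ≤ ζ) (hζ' : ζ < 1 / 2) :
    AntitoneOn (deriv u) (Ioi 0) := by
  refine antitoneOn_of_hasDerivAt_nonpos (convex_Ioi 0) h.eq_u fun τ _ => ?_
  have := (sq_nonneg _).trans (sq_V_le_source (k := k) (v := v) hζ hζ' τ)
  exact mul_nonpos_of_nonpos_of_nonneg (neg_nonpos.2 (Real.exp_pos _).le) this

theorem IsSolution.exists_deriv_u_eq_slope (h : IsSolution k ζ u v) {σ τ : ℝ} (hσ : 0 < σ)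
    (hστ : σ < τ) : ∃ c ∈ Ioo σ τ, deriv u c = (u τ - u σ) / (τ - σ) :=
  exists_deriv_eq_slope u hστ
    (fun _ hx => (h.hasDerivAt_u (hσ.trans_le hx.1)).continuousAt.continuousWithinAt)
    (fun _ hx => (h.hasDerivAt_u (hσ.trans hx.1)).differentiableAt.differentiableWithinAt)

/-- Concavity of `u`: a chord has slope at most the derivative at its left end. -/
theorem IsSolution.sub_le_deriv_mul (h : IsSolution k ζ u v) (hζ : 0 ≤ ζ) (hζ' : ζ < 1 / 2)
    {σ τ : ℝ} (hσ : 0 < σ) (hστ : σ < τ) : u τ - u σ ≤ deriv u σ * (τ - σ) := by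
  obtain ⟨c, hc, hcs⟩ := h.exists_deriv_u_eq_slope hσ hστ
  have := h.antitoneOn_deriv_u hζ hζ' hσ (hσ.trans hc.1) hc.1.le
  rwa [hcs, div_le_iff₀ (sub_pos.2 hστ)] at this

/-- Concavity of `u`: a chord has slope at least the derivative at its right end. -/
theorem IsSolution.deriv_mul_le_sub (h : IsSolution k ζ u v) (hζ : 0 ≤ ζ) (hζ' : ζ < 1 / 2)
    {σ τ : ℝ} (hσ : 0 < σ) (hστ : σ < τ) : deriv u τ * (τ - σ) ≤ u τ - u σ := by
  obtain ⟨c, hc, hcs⟩ := h.exists_deriv_u_eq_slope hσ hστ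
  have := h.antitoneOn_deriv_u hζ hζ' (hσ.trans hc.1) (hσ.trans hστ) hc.2.le
  rwa [hcs, le_div_iff₀ (sub_pos.2 hστ)] at this

theorem HasAsymptotics.tendsto_u_div (ha : HasAsymptotics k u v) :
    Tendsto (fun τ => u τ / τ) atTop (𝓝 ((k : ℝ) + 1)) := by
  have hk : (k : ℝ) + 1 ≠ 0 := by positivity
  have h1 := (isEquivalent_iff_tendsto_one (u := u) (v := fun τ : ℝ => ((k : ℝ) + 1) * τ) (by
    filter_upwards [eventually_gt_atTop 0] with τ hτ
    exact mul_ne_zero hk hτ.ne')).1 ha.u_top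
  have h2 := h1.mul_const ((k : ℝ) + 1)
  rw [one_mul] at h2
  refine h2.congr' ?_
  filter_upwards [eventually_gt_atTop 0] with τ hτ
  simp only [Pi.div_apply]
  field_simp

theorem IsSolution.le_deriv_u (h : IsSolution k ζ u v) (ha : HasAsymptotics k u v) (hζ : 0 ≤ ζ)
    (hζ' : ζ < 1 / 2) {τ : ℝ} (hτ : 0 < τ) : (k : ℝ) + 1 ≤ deriv u τ := by
  have h1 : Tendsto (fun σ : ℝ => u τ / σ + deriv u τ * (1 - τ / σ)) atTop
      (𝓝 (0 + deriv u τ * (1 - 0))) :=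
    (tendsto_const_nhds.div_atTop tendsto_id).add
      ((tendsto_const_nhds.sub (tendsto_const_nhds.div_atTop tendsto_id)).const_mul _)
  rw [zero_add, sub_zero, mul_one] at h1
  refine le_of_tendsto_of_tendsto ha.tendsto_u_div h1 ?_
  filter_upwards [eventually_gt_atTop τ] with σ hσ
  have h2 := h.sub_le_deriv_mul hζ hζ' hτ hσ
  have hσ0 := hτ.trans hσ
  have h3 : u τ / σ + deriv u τ * (1 - τ / σ) = (u τ + deriv u τ * (σ - τ)) / σ := by
    field_simp
  rw [h3]
  gcongr
  linarith

theorem IsSolution.tendsto_deriv_u (h : IsSolution k ζ u v) (ha : HasAsymptotics k u v)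
    (hζ : 0 ≤ ζ) (hζ' : ζ < 1 / 2) : Tendsto (deriv u) atTop (𝓝 ((k : ℝ) + 1)) := by
  have h2 : Tendsto (fun τ : ℝ => 2 * (u τ / τ) - u (τ / 2) / (τ / 2)) atTop
      (𝓝 (2 * ((k : ℝ) + 1) - ((k : ℝ) + 1))) :=
    (ha.tendsto_u_div.const_mul 2).sub
      (ha.tendsto_u_div.comp (tendsto_id.atTop_div_const two_pos))
  rw [two_mul, add_sub_cancel_right] at h2
  refine tendsto_of_tendsto_of_tendsto_of_le_of_le' tendsto_const_nhds h2 ?_ ?_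
  · filter_upwards [eventually_gt_atTop 0] with τ hτ using h.le_deriv_u ha hζ hζ' hτ
  · filter_upwards [eventually_gt_atTop 0] with τ hτ
    have h3 := h.deriv_mul_le_sub hζ hζ' (half_pos hτ) (half_lt_self hτ)
    have h4 : 2 * (u τ / τ) - u (τ / 2) / (τ / 2) = (u τ - u (τ / 2)) / (τ / 2) := by
      field_simp
    rw [h4, le_div_iff₀ (half_pos hτ)]
    linarith

theorem IsSolution.add_mul_le_u (h : IsSolution k ζ u v) (ha : HasAsymptotics k u v)
    (hζ : 0 ≤ ζ) (hζ' : ζ < 1 / 2) {σ τ : ℝ} (hσ : 0 < σ) (hστ : σ ≤ τ) :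
    u σ + ((k : ℝ) + 1) * (τ - σ) ≤ u τ := by
  rcases hστ.eq_or_lt with rfl | hlt
  · simp
  · have h1 := h.deriv_mul_le_sub hζ hζ' hσ hlt
    have h2 := h.le_deriv_u ha hζ hζ' (hσ.trans hlt)
    nlinarith [sub_pos.2 hlt]

theorem IsSolution.tendsto_exp_neg_u (h : IsSolution k ζ u v) (ha : HasAsymptotics k u v)
    (hζ : 0 ≤ ζ) (hζ' : ζ < 1 / 2) : Tendsto (fun τ => Real.exp (-u τ)) atTop (𝓝 0) := by
  have hk : (0 : ℝ) < k + 1 := by positivity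
  refine Real.tendsto_exp_neg_atTop_nhds_zero.comp ?_
  refine tendsto_atTop_mono' (f₁ := fun τ : ℝ => (u 1 - ((k : ℝ) + 1)) + ((k : ℝ) + 1) * τ) _ ?_
    (tendsto_atTop_add_const_left _ _ (tendsto_id.const_mul_atTop hk))
  filter_upwards [eventually_ge_atTop 1] with τ hτ
  have := h.add_mul_le_u ha hζ hζ' one_pos hτ
  linarith

theorem IsSolution.tendsto_exp_neg_u_mul_v (h : IsSolution k ζ u v) (ha : HasAsymptotics k u v)
    (hζ : 0 ≤ ζ) (hζ' : ζ < 1 / 2) : Tendsto (fun τ => Real.exp (-u τ) * v τ) atTop (𝓝 0) := by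
  obtain ⟨C, ε, hε, hC⟩ := ha.v_top
  have hk : (0 : ℝ) < k + 1 := by positivity
  have h1 : Tendsto (fun τ : ℝ => (Real.exp (-(u 1 - ((k : ℝ) + 1))) * C) *
      Real.exp (-(((k : ℝ) + 1) * ε * τ))) atTop
      (𝓝 ((Real.exp (-(u 1 - ((k : ℝ) + 1))) * C) * 0)) :=
    (Real.tendsto_exp_neg_atTop_nhds_zero.comp
      (tendsto_id.const_mul_atTop (mul_pos hk hε))).const_mul _
  rw [mul_zero] at h1
  refine squeeze_zero_norm' ?_ h1
  filter_upwards [hC, eventually_ge_atTop 1] with τ hτ hτ1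
  have h2 := h.add_mul_le_u ha hζ hζ' one_pos hτ1
  rw [norm_mul, Real.norm_eq_abs, Real.norm_eq_abs, abs_of_pos (Real.exp_pos _)]
  calc Real.exp (-u τ) * |v τ|
      ≤ Real.exp (-(u 1 - ((k : ℝ) + 1)) - ((k : ℝ) + 1) * τ) *
        (C * Real.exp (((k : ℝ) + 1) * (1 - ε) * τ)) := by
        gcongr
        linarith
    _ = _ := by
        rw [mul_left_comm, ← Real.exp_add, mul_comm (Real.exp _) C, mul_assoc C, ← Real.exp_add]
        congr 2
        ring

/-- There is a sequence tending to infinity along which `e^{-u} v'` tends to zero: the mean value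
theorem gives points where `v'` is bounded by values of `v`. -/
theorem IsSolution.exists_seq_tendsto (h : IsSolution k ζ u v) (ha : HasAsymptotics k u v)
    (hζ : 0 ≤ ζ) (hζ' : ζ < 1 / 2) : ∃ s : ℕ → ℝ, Tendsto s atTop atTop ∧
      Tendsto (fun n => Real.exp (-u (s n)) * deriv v (s n)) atTop (𝓝 0) := by
  have hslope : ∀ n : ℕ, ∃ c ∈ Ioo ((n : ℝ) + 1) (n + 2),
      deriv v c = (v (n + 2) - v (n + 1)) / ((n + 2) - (n + 1)) := fun n =>
    exists_deriv_eq_slope v (by linarith)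
      (fun x hx => (h.hasDerivAt_v (lt_of_lt_of_le (by positivity) hx.1)).continuousAt
        |>.continuousWithinAt)
      (fun x hx => (h.hasDerivAt_v (lt_trans (by positivity) hx.1)).differentiableAt
        |>.differentiableWithinAt)
  choose s hs hsd using hslope
  have hnat : ∀ c : ℝ, Tendsto (fun n : ℕ => (n : ℝ) + c) atTop atTop := fun c =>
    tendsto_atTop_add_const_right _ _ tendsto_natCast_atTop_atTop
  refine ⟨s, tendsto_atTop_mono (fun n => (hs n).1.le) (hnat 1), ?_⟩
  have hlim := h.tendsto_exp_neg_u_mul_v ha hζ hζ'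
  have h1 := (hlim.comp (hnat 1)).abs.add ((hlim.comp (hnat 2)).abs.const_mul
    (Real.exp (deriv u 1)))
  rw [abs_zero, mul_zero, add_zero] at h1
  refine squeeze_zero_norm (fun n => ?_) h1
  have hn1 : (0 : ℝ) < n + 1 := by positivity
  have hk : (0 : ℝ) < k + 1 := by positivity
  have hu1 : u (n + 1) ≤ u (s n) := by
    have := h.add_mul_le_u ha hζ hζ' hn1 (hs n).1.le
    nlinarith [(hs n).1]
  have hu2 : u (n + 2) - deriv u 1 ≤ u (n + 1) := by
    have h2 := h.sub_le_deriv_mul hζ hζ' hn1 (by linarith : (n : ℝ) + 1 < n + 2)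
    have h3 := h.antitoneOn_deriv_u hζ hζ' (mem_Ioi.2 one_pos) (mem_Ioi.2 hn1) (by simp)
    linarith
  have hd : |deriv v (s n)| ≤ |v (n + 1)| + |v (n + 2)| := by
    rw [hsd n, show (n : ℝ) + 2 - (n + 1) = 1 by ring, div_one]
    exact (abs_sub (v (n + 2)) (v (n + 1))).trans_eq (add_comm _ _)
  simp only [Function.comp_apply, norm_mul, Real.norm_eq_abs, abs_mul, Real.abs_exp]
  calc Real.exp (-u (s n)) * |deriv v (s n)|
      ≤ Real.exp (-u (n + 1)) * (|v (n + 1)| + |v (n + 2)|) := by gcongr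
    _ = Real.exp (-u (n + 1)) * |v (n + 1)| + Real.exp (-u (n + 1)) * |v (n + 2)| := mul_add _ _ _
    _ ≤ Real.exp (-u (n + 1)) * |v (n + 1)| +
        Real.exp (deriv u 1 + -u (n + 2)) * |v (n + 2)| := by
        gcongr
        linarith
    _ = _ := by rw [Real.exp_add, mul_assoc]

theorem IsSolution.energy_eq_sq (h : IsSolution k ζ u v) (ha : HasAsymptotics k u v)
    (hζ : 0 ≤ ζ) (hζ' : ζ < 1 / 2) {τ : ℝ} (hτ : 0 < τ) :
    energy k ζ u v τ = ((k : ℝ) + 1) ^ 2 := by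
  obtain ⟨s, hs, hsq⟩ := h.exists_seq_tendsto ha hζ hζ'
  have h1 := (h.tendsto_deriv_u ha hζ hζ').comp hs
  have h2 := (h.tendsto_exp_neg_u ha hζ hζ').comp hs
  have h3 := (h.tendsto_exp_neg_u_mul_v ha hζ hζ').comp hs
  have h4 := (h1.pow 2).add (((hsq.pow 2).const_mul (ζ ^ 2)).sub
    (((h2.sub (h3.const_mul (ζ ^ 2 * ((k : ℝ) + 1)))).pow 2).const_mul 4))
  simp only [mul_zero, sub_zero, ne_eq, OfNat.ofNat_ne_zero, not_false_eq_true, zero_pow,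
    add_zero] at h4
  refine tendsto_nhds_unique (tendsto_const_nhds.congr' ?_) h4
  filter_upwards [hs.eventually_gt_atTop 0] with n hn
  rw [h.energy_eq hτ hn, energy, V]
  simp only [Function.comp_apply]
  have : Real.exp (-2 * u (s n)) = Real.exp (-u (s n)) ^ 2 := by
    rw [← Real.exp_nat_mul]
    push_cast
    ring_nf
  rw [this]
  ring

end Solution

/-! ### A priori bounds -/

section Bounds

variable {k : ℕ} {ζ : ℝ} {u v : ℝ → ℝ}

/-- Bounds for a solution whose constants depend on `k` and `C` only. They are closed under
pointwise limits of `u`, `u'`, `v`, `v'` and `ζ`. -/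
structure AprioriBounds (k : ℕ) (C ζ : ℝ) (u v : ℝ → ℝ) : Prop where
  energy_eq : ∀ τ, 0 < τ → energy k ζ u v τ = ((k : ℝ) + 1) ^ 2
  le_deriv_u : ∀ τ, 0 < τ → (k : ℝ) + 1 ≤ deriv u τ
  exp_u_le : ∀ τ, 0 < τ → Real.exp (u τ) ≤ 2 * τ * Real.exp (((k : ℝ) + 1) * τ)
  le_exp_u : ∀ τ, 0 < τ → Real.exp (-2 * ((k : ℝ) + 1)) / 2 * min τ 1 *
    Real.exp (((k : ℝ) + 1) * τ) ≤ Real.exp (u τ)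
  abs_V_le : ∀ τ, 0 < τ → |V k ζ v τ| ≤ Real.exp (2 * ζ * ((k : ℝ) + 1) * τ)
  abs_deriv_v_le : ∀ τ, 0 < τ →
    |deriv v τ| ≤ C * (τ + τ ^ 2) * Real.exp (2 * ζ * ((k : ℝ) + 1) * τ)
  abs_v_le : ∀ τ, 0 < τ → |v τ| ≤ C * (τ ^ 2 + τ ^ 3) * Real.exp (2 * ζ * ((k : ℝ) + 1) * τ)

theorem exp_neg_two_mul_eq (x : ℝ) : Real.exp (-2 * x) = (Real.exp x ^ 2)⁻¹ := by
  rw [← Real.exp_nat_mul, ← Real.exp_neg]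
  push_cast
  ring_nf

/-- The conservation law, solved for the square of the derivative of `e^u`. -/
theorem sq_exp_u_mul_deriv_u {τ : ℝ} (he : energy k ζ u v τ = ((k : ℝ) + 1) ^ 2) :
    (Real.exp (u τ) * deriv u τ) ^ 2 = ((k : ℝ) + 1) ^ 2 * Real.exp (u τ) ^ 2 +
      4 * V k ζ v τ ^ 2 - ζ ^ 2 * deriv v τ ^ 2 := by
  have hy := (Real.exp_pos (u τ)).ne'
  rw [energy, exp_neg_two_mul_eq] at he
  field_simp at he
  nlinarith

theorem sq_mul_deriv_v_le {τ : ℝ} (he : energy k ζ u v τ = ((k : ℝ) + 1) ^ 2)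
    (hg : (k : ℝ) + 1 ≤ deriv u τ) : (ζ * deriv v τ) ^ 2 ≤ (2 * V k ζ v τ) ^ 2 := by
  have h1 := sq_exp_u_mul_deriv_u he
  have hk : (0 : ℝ) ≤ k + 1 := by positivity
  have h2 : (((k : ℝ) + 1) * Real.exp (u τ)) ^ 2 ≤ (Real.exp (u τ) * deriv u τ) ^ 2 := by
    apply pow_le_pow_left₀ (by positivity)
    rw [mul_comm]
    gcongr
  nlinarith

/-- The derivative of `e^u` exceeds `(k + 1) e^u` by at most `2 |V|`. -/
theorem exp_u_mul_deriv_u_le {τ : ℝ} (he : energy k ζ u v τ = ((k : ℝ) + 1) ^ 2) :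
    Real.exp (u τ) * deriv u τ ≤ ((k : ℝ) + 1) * Real.exp (u τ) + 2 * |V k ζ v τ| := by
  have h1 := sq_exp_u_mul_deriv_u he
  refine abs_le_of_sq_le_sq' ?_ (by positivity) |>.2
  have h2 : 0 ≤ ((k : ℝ) + 1) * Real.exp (u τ) * |V k ζ v τ| := by positivity
  nlinarith [sq_abs (V k ζ v τ), sq_nonneg (ζ * deriv v τ)]

theorem HasAsymptotics.tendsto_exp_u_zero (ha : HasAsymptotics k u v) :
    Tendsto (fun τ => Real.exp (u τ)) (𝓝[>] 0) (𝓝 0) :=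
  Real.tendsto_exp_atBot.comp (ha.u_zero.symm.tendsto_atBot Real.tendsto_log_nhdsGT_zero)

theorem HasAsymptotics.tendsto_v_zero (ha : HasAsymptotics k u v) :
    Tendsto v (𝓝[>] 0) (𝓝 0) := by
  have h1 : Tendsto (fun τ : ℝ => τ ^ 2) (𝓝[>] 0) (𝓝 0) :=
    ((continuous_pow 2).tendsto' 0 0 (by simp)).mono_left nhdsWithin_le_nhds
  have h2 := ha.v_zero.mul h1
  rw [mul_zero] at h2
  refine h2.congr' ?_
  filter_upwards [self_mem_nhdsWithin] with τ hτ
  exact div_mul_cancel₀ _ (pow_ne_zero 2 (ne_of_gt hτ))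

theorem HasAsymptotics.tendsto_V_zero (ha : HasAsymptotics k u v) (ζ : ℝ) :
    Tendsto (V k ζ v) (𝓝[>] 0) (𝓝 1) := by
  have := (ha.tendsto_v_zero.const_mul (ζ ^ 2 * ((k : ℝ) + 1))).const_sub 1
  rwa [mul_zero, sub_zero] at this

variable (h : IsSolution k ζ u v) (ha : HasAsymptotics k u v) (hζ : 0 ≤ ζ) (hζ' : ζ < 1 / 2)

include h ha hζ hζ'

theorem IsSolution.abs_V_mul_deriv_v_le {τ : ℝ} (hτ : 0 < τ) :
    |V k ζ v τ * (ζ ^ 2 * ((k : ℝ) + 1) * deriv v τ)| ≤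
      2 * ζ * ((k : ℝ) + 1) * V k ζ v τ ^ 2 := by
  have h1 := sq_le_sq.1 (sq_mul_deriv_v_le (h.energy_eq_sq ha hζ hζ' hτ)
    (h.le_deriv_u ha hζ hζ' hτ))
  rw [abs_mul 2, abs_two] at h1
  have hk : (0 : ℝ) < k + 1 := by positivity
  have h2 : V k ζ v τ * (ζ ^ 2 * ((k : ℝ) + 1) * deriv v τ) =
      (ζ * ((k : ℝ) + 1)) * (V k ζ v τ * (ζ * deriv v τ)) := by ring
  rw [h2, abs_mul, abs_mul (V k ζ v τ), abs_of_nonneg (mul_nonneg hζ hk.le), ← sq_abs (V k ζ v τ)]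
  calc ζ * ((k : ℝ) + 1) * (|V k ζ v τ| * |ζ * deriv v τ|)
      ≤ ζ * ((k : ℝ) + 1) * (|V k ζ v τ| * (2 * |V k ζ v τ|)) := by gcongr
    _ = _ := by ring

/-- Two-sided exponential bounds for `V`, from `|V'| ≤ 2 ζ (k + 1) |V|` and `V(0) = 1`. -/
theorem IsSolution.sq_V_bounds {τ : ℝ} (hτ : 0 < τ) :
    Real.exp (-2 * (2 * ζ * ((k : ℝ) + 1) * τ)) ≤ V k ζ v τ ^ 2 ∧
      V k ζ v τ ^ 2 ≤ Real.exp (2 * (2 * ζ * ((k : ℝ) + 1) * τ)) := by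
  set K := 2 * ζ * ((k : ℝ) + 1) with hK
  have hexp : ∀ c x : ℝ, HasDerivAt (fun x => Real.exp (c * (K * x)))
      (Real.exp (c * (K * x)) * (c * K)) x := fun c x => by
    have := (((hasDerivAt_id x).const_mul K).const_mul c).exp
    simpa using this
  have hlim : ∀ c : ℝ, Tendsto (fun x => Real.exp (c * (K * x)) * V k ζ v x ^ 2) (𝓝[>] 0)
      (𝓝 1) := fun c => by
    have h1 : Tendsto (fun x => Real.exp (c * (K * x))) (𝓝[>] 0) (𝓝 1) :=
      ((by fun_prop : Continuous fun x => Real.exp (c * (K * x))).tendsto' 0 1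
        (by simp)).mono_left nhdsWithin_le_nhds
    simpa using h1.mul ((ha.tendsto_V_zero ζ).pow 2)
  have hder : ∀ c, ∀ x ∈ Ioo 0 (τ + 1), HasDerivAt (fun x => Real.exp (c * (K * x)) * V k ζ v x ^ 2)
      (Real.exp (c * (K * x)) * (c * K * V k ζ v x ^ 2 -
        2 * (V k ζ v x * (ζ ^ 2 * ((k : ℝ) + 1) * deriv v x)))) x := fun c x hx =>
    ((hexp c x).mul ((h.hasDerivAt_V hx.1).pow 2)).congr_deriv
      (by simp only [Pi.pow_apply]; push_cast; ring)
  have hmem : τ ∈ Ioo 0 (τ + 1) := ⟨hτ, by linarith⟩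
  constructor
  · have h1 := le_of_tendsto_of_hasDerivAt_nonneg (hder 2) (fun x hx =>
      mul_nonneg (Real.exp_pos _).le
        (by linarith [(abs_le.1 (h.abs_V_mul_deriv_v_le ha hζ hζ' hx.1)).2])) (hlim 2) hmem
    rw [neg_mul, Real.exp_neg]
    rw [inv_le_iff_one_le_mul₀ (Real.exp_pos _)]
    linarith
  · have h1 := le_of_tendsto_of_hasDerivAt_nonneg (fun x hx => (hder (-2) x hx).neg) (fun x hx => by
      rw [← mul_neg]
      exact mul_nonneg (Real.exp_pos _).le
        (by linarith [(abs_le.1 (h.abs_V_mul_deriv_v_le ha hζ hζ' hx.1)).1])) (hlim (-2)).neg hmem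
    simp only [Pi.neg_apply] at h1
    rw [neg_mul, Real.exp_neg] at h1
    have h2 : (Real.exp (2 * (K * τ)))⁻¹ * V k ζ v τ ^ 2 ≤ 1 := by linarith
    rwa [inv_mul_le_iff₀ (Real.exp_pos _), mul_one] at h2

theorem IsSolution.abs_V_le {τ : ℝ} (hτ : 0 < τ) :
    |V k ζ v τ| ≤ Real.exp (2 * ζ * ((k : ℝ) + 1) * τ) := by
  have h1 := (h.sq_V_bounds ha hζ hζ' hτ).2
  refine abs_le_of_sq_le_sq ?_ (Real.exp_pos _).le
  rwa [← Real.exp_nat_mul]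

omit h ha in
theorem two_mul_mul_le {τ : ℝ} (hτ : 0 < τ) :
    0 ≤ 2 * ζ * ((k : ℝ) + 1) * τ ∧ 2 * ζ * ((k : ℝ) + 1) * τ ≤ ((k : ℝ) + 1) * τ := by
  have hk : (0 : ℝ) < k + 1 := by positivity
  refine ⟨by positivity, ?_⟩
  gcongr
  nlinarith

theorem IsSolution.exp_u_le {τ : ℝ} (hτ : 0 < τ) :
    Real.exp (u τ) ≤ 2 * τ * Real.exp (((k : ℝ) + 1) * τ) := by
  have hder : ∀ x ∈ Ioo 0 (τ + 1), HasDerivAt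
      (fun x => 2 * x - Real.exp (-(((k : ℝ) + 1) * x)) * Real.exp (u x))
      (2 - Real.exp (-(((k : ℝ) + 1) * x)) *
        (Real.exp (u x) * deriv u x - ((k : ℝ) + 1) * Real.exp (u x))) x := fun x hx => by
    have h1 := ((hasDerivAt_id x).const_mul ((k : ℝ) + 1)).neg.exp
    have h2 := ((hasDerivAt_id x).const_mul 2).sub (h1.mul (h.hasDerivAt_exp_u hx.1))
    refine h2.congr_deriv ?_
    simp only [Pi.neg_apply, id]
    ring
  have hlim : Tendsto (fun x => 2 * x - Real.exp (-(((k : ℝ) + 1) * x)) * Real.exp (u x)) (𝓝[>] 0)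
      (𝓝 0) := by
    have h1 : Tendsto (fun x : ℝ => 2 * x) (𝓝[>] 0) (𝓝 0) :=
      ((by fun_prop : Continuous fun x : ℝ => 2 * x).tendsto' 0 0
        (by simp)).mono_left nhdsWithin_le_nhds
    have h2 : Tendsto (fun x : ℝ => Real.exp (-(((k : ℝ) + 1) * x))) (𝓝[>] 0) (𝓝 1) :=
      ((by fun_prop : Continuous fun x : ℝ => Real.exp (-(((k : ℝ) + 1) * x))).tendsto' 0 1
        (by simp)).mono_left nhdsWithin_le_nhds
    simpa using h1.sub (h2.mul ha.tendsto_exp_u_zero)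
  have h1 := le_of_tendsto_of_hasDerivAt_nonneg hder (fun x hx => by
    have h2 := exp_u_mul_deriv_u_le (h.energy_eq_sq ha hζ hζ' hx.1)
    have h3 := (h.abs_V_le ha hζ hζ' hx.1).trans
      (Real.exp_le_exp.2 (two_mul_mul_le (k := k) hζ hζ' hx.1).2)
    have h4 : Real.exp (-(((k : ℝ) + 1) * x)) *
        (Real.exp (u x) * deriv u x - ((k : ℝ) + 1) * Real.exp (u x)) ≤
        Real.exp (-(((k : ℝ) + 1) * x)) * (2 * Real.exp (((k : ℝ) + 1) * x)) := by
      gcongr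
      linarith
    rw [mul_left_comm, ← Real.exp_add, neg_add_cancel, Real.exp_zero, mul_one] at h4
    linarith) hlim (⟨hτ, by linarith⟩ : τ ∈ Ioo 0 (τ + 1))
  rw [Real.exp_neg] at h1
  rw [← div_le_iff₀ (Real.exp_pos _), div_eq_inv_mul]
  linarith

/-- The lower bound for `e^u` near `0`. With `Y = e^{u(t)}`, the function `e^u` rises from `0` to
`Y` on `(0, t]` with speed at least `e^{-(k+1)} √(1 - e^u / Y)`, and so `-2 Y √(1 - e^u / Y)`
rises from `-2 Y` to `0` with speed at least `e^{-(k+1)}`. -/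
theorem IsSolution.le_exp_u_of_le_one {t : ℝ} (ht : 0 < t) (ht1 : t ≤ 1) :
    Real.exp (-((k : ℝ) + 1)) * t ≤ 2 * Real.exp (u t) := by
  have hk : (0 : ℝ) < k + 1 := by positivity
  set c := Real.exp (-((k : ℝ) + 1)) with hc
  have hc0 : 0 < c := Real.exp_pos _
  set Y := Real.exp (u t) with hY
  have hY0 : 0 < Y := Real.exp_pos _
  have hV : ∀ s, 0 < s → s ≤ t → c ^ 2 ≤ V k ζ v s ^ 2 := fun s hs hst => by
    refine le_trans ?_ (h.sq_V_bounds ha hζ hζ' hs).1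
    rw [hc, ← Real.exp_nat_mul]
    refine Real.exp_le_exp.2 ?_
    have := (two_mul_mul_le (k := k) hζ hζ' hs).2
    push_cast
    nlinarith
  have hmono : AntitoneOn (fun s => deriv u s ^ 2 - c ^ 2 * Real.exp (-2 * u s)) (Ioc 0 t) := by
    refine antitoneOn_of_hasDerivAt_nonpos (convex_Ioc 0 t) (fun s hs =>
      ((h.eq_u s hs.1).pow 2).sub ((h.hasDerivAt_exp_neg_two_u hs.1).const_mul (c ^ 2)))
      fun s hs => ?_
    have h1 := (hV s hs.1 hs.2).trans (sq_V_le_source (k := k) (v := v) hζ hζ' s)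
    have h2 := hk.le.trans (h.le_deriv_u ha hζ hζ' hs.1)
    have h3 : 0 ≤ deriv u s * Real.exp (-2 * u s) := mul_nonneg h2 (Real.exp_pos _).le
    have h4 := mul_le_mul_of_nonneg_left h1 h3
    push_cast
    nlinarith
  have hlt : ∀ s ∈ Ioo 0 t, Real.exp (u s) < Y := fun s hs => by
    refine Real.exp_lt_exp.2 ?_
    have := h.add_mul_le_u ha hζ hζ' hs.1 hs.2.le
    nlinarith [hs.2]
  have hpos : ∀ s ∈ Ioo 0 t, 0 < 1 - Real.exp (u s) / Y := fun s hs =>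
    sub_pos.2 ((div_lt_one hY0).2 (hlt s hs))
  have hspeed : ∀ s ∈ Ioo 0 t, c * √(1 - Real.exp (u s) / Y) ≤ Real.exp (u s) * deriv u s := by
    intro s hs
    have h1 := hmono ⟨hs.1, hs.2.le⟩ ⟨ht, le_rfl⟩ hs.2.le
    simp only [exp_neg_two_mul_eq] at h1
    have hy0 := Real.exp_pos (u s)
    set y := Real.exp (u s) with hy
    have hg := hk.le.trans (h.le_deriv_u ha hζ hζ' hs.1)
    refine abs_le_of_sq_le_sq' ?_ (mul_nonneg hy0.le hg) |>.2
    rw [mul_pow, Real.sq_sqrt (hpos s hs).le, mul_pow]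
    have h2 : c ^ 2 * (y ^ 2)⁻¹ - c ^ 2 * (Y ^ 2)⁻¹ ≤ deriv u s ^ 2 := by
      nlinarith [sq_nonneg (deriv u t)]
    have h3 : y ^ 2 * (c ^ 2 * (y ^ 2)⁻¹ - c ^ 2 * (Y ^ 2)⁻¹) = c ^ 2 * (1 - (y / Y) ^ 2) := by
      field_simp
    have h4 : (y / Y) ^ 2 ≤ y / Y := by
      have h5 : y / Y ≤ 1 := ((div_lt_one hY0).2 (hlt s hs)).le
      have h6 : 0 ≤ y / Y := by positivity
      nlinarith
    calc c ^ 2 * (1 - y / Y) ≤ c ^ 2 * (1 - (y / Y) ^ 2) := by gcongr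
      _ ≤ _ := by rw [← h3]; gcongr
  have hder : ∀ s ∈ Ioo 0 t, HasDerivAt (fun s => -2 * Y * √(1 - Real.exp (u s) / Y) - c * s)
      (Real.exp (u s) * deriv u s / √(1 - Real.exp (u s) / Y) - c) s := fun s hs => by
    have h1 := (((((h.hasDerivAt_exp_u hs.1).div_const Y).const_sub 1).sqrt
      (hpos s hs).ne').const_mul (-2 * Y)).sub ((hasDerivAt_id s).const_mul c)
    refine h1.congr_deriv ?_
    have := (Real.sqrt_pos.2 (hpos s hs)).ne'
    field_simp
  have hlim : Tendsto (fun s => -2 * Y * √(1 - Real.exp (u s) / Y) - c * s) (𝓝[>] 0)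
      (𝓝 (-2 * Y)) := by
    have h1 := (((ha.tendsto_exp_u_zero.div_const Y).const_sub 1).sqrt.const_mul (-2 * Y))
    have h2 : Tendsto (fun x : ℝ => c * x) (𝓝[>] 0) (𝓝 0) :=
      ((by fun_prop : Continuous fun x : ℝ => c * x).tendsto' 0 0
        (by simp)).mono_left nhdsWithin_le_nhds
    simpa using h1.sub h2
  have hle : ∀ s ∈ Ioo 0 t, c * s ≤ 2 * Y := fun s hs => by
    have h1 := le_of_tendsto_of_hasDerivAt_nonneg hder (fun s hs => by
      rw [sub_nonneg, le_div_iff₀ (Real.sqrt_pos.2 (hpos s hs))]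
      exact hspeed s hs) hlim hs
    have h2 : 0 ≤ Y * √(1 - Real.exp (u s) / Y) := by positivity
    linarith
  have hlim' : Tendsto (fun s => c * s) (𝓝[<] t) (𝓝 (c * t)) :=
    ((continuous_const_mul c).tendsto t).mono_left nhdsWithin_le_nhds
  exact le_of_tendsto hlim' (by filter_upwards [Ioo_mem_nhdsLT ht] with s hs using hle s hs)

theorem IsSolution.le_exp_u {τ : ℝ} (hτ : 0 < τ) :
    Real.exp (-2 * ((k : ℝ) + 1)) / 2 * min τ 1 * Real.exp (((k : ℝ) + 1) * τ) ≤
      Real.exp (u τ) := by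
  have hk : (0 : ℝ) < k + 1 := by positivity
  have hsplit : Real.exp (-2 * ((k : ℝ) + 1)) = Real.exp (-((k : ℝ) + 1)) *
      Real.exp (-((k : ℝ) + 1)) := by
    rw [← Real.exp_add]
    ring_nf
  rcases le_total τ 1 with h1 | h1
  · have h2 := h.le_exp_u_of_le_one ha hζ hζ' hτ h1
    rw [min_eq_left h1]
    have h3 : Real.exp (-((k : ℝ) + 1)) * Real.exp (((k : ℝ) + 1) * τ) ≤ 1 := by
      rw [← Real.exp_add, Real.exp_le_one_iff]
      nlinarith
    calc _ = Real.exp (-((k : ℝ) + 1)) * τ / 2 *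
          (Real.exp (-((k : ℝ) + 1)) * Real.exp (((k : ℝ) + 1) * τ)) := by rw [hsplit]; ring
      _ ≤ Real.exp (-((k : ℝ) + 1)) * τ / 2 * 1 := by gcongr
      _ ≤ _ := by linarith
  · have h2 := h.le_exp_u_of_le_one ha hζ hζ' one_pos le_rfl
    have h3 := Real.exp_le_exp.2 (h.add_mul_le_u ha hζ hζ' one_pos h1)
    rw [min_eq_right h1]
    refine le_trans ?_ h3
    have h4 : Real.exp (u 1 + ((k : ℝ) + 1) * (τ - 1)) = Real.exp (u 1) *
        (Real.exp (-((k : ℝ) + 1)) * Real.exp (((k : ℝ) + 1) * τ)) := by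
      rw [← Real.exp_add, ← Real.exp_add]
      ring_nf
    rw [h4, hsplit]
    calc _ = (Real.exp (-((k : ℝ) + 1)) * 1 / 2) *
          (Real.exp (-((k : ℝ) + 1)) * Real.exp (((k : ℝ) + 1) * τ)) := by ring
      _ ≤ _ := by
        gcongr
        linarith

end Bounds

section VelocityBound

variable {k : ℕ} {ζ : ℝ} {u v : ℝ → ℝ}
variable (h : IsSolution k ζ u v) (ha : HasAsymptotics k u v) (hζ : 0 ≤ ζ) (hζ' : ζ < 1 / 2)

/-- The constant in the bounds for `v` and `v'`. With `c = e^{-2(k+1)} / 2` from the lower bound of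
`e^u`, it is `4 * (4 * b / c²)`, where `b = 2 (k + 1) + 2 / c` bounds `|u' tanh τ - (k + 1)|`. -/
noncomputable def boundConst (k : ℕ) : ℝ :=
  4 * (4 * (2 * ((k : ℝ) + 1) + 2 / (Real.exp (-2 * ((k : ℝ) + 1)) / 2)) /
    (Real.exp (-2 * ((k : ℝ) + 1)) / 2) ^ 2)

theorem boundConst_pos (k : ℕ) : 0 < boundConst k := by
  unfold boundConst
  positivity

theorem IsSolution.hasDerivAt_exp_mul_deriv_v (h : IsSolution k ζ u v) {τ : ℝ} (hτ : 0 < τ) :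
    HasDerivAt (fun τ => Real.exp (-2 * u τ) * deriv v τ)
      (4 * Real.exp (-2 * u τ) * V k ζ v τ * (deriv u τ * Real.tanh τ - ((k : ℝ) + 1))) τ := by
  refine ((h.hasDerivAt_exp_neg_two_u hτ).mul (h.eq_v τ hτ)).congr_deriv ?_
  ring

include h ha hζ hζ'

theorem IsSolution.abs_deriv_u_mul_tanh_sub_le {τ : ℝ} (hτ : 0 < τ) :
    |deriv u τ * Real.tanh τ - ((k : ℝ) + 1)| ≤
      2 * ((k : ℝ) + 1) + 2 / (Real.exp (-2 * ((k : ℝ) + 1)) / 2) := by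
  set c := Real.exp (-2 * ((k : ℝ) + 1)) / 2 with hc
  have hc0 : 0 < c := by positivity
  have hk : (0 : ℝ) < k + 1 := by positivity
  have hT0 := tanh_nonneg_of_nonneg hτ.le
  have hT1 : Real.tanh τ ≤ min τ 1 := le_min (tanh_le_self hτ.le) tanh_le_one
  have hg := hk.le.trans (h.le_deriv_u ha hζ hζ' hτ)
  have hy := h.le_exp_u ha hζ hζ' hτ
  rw [← hc] at hy
  have hy0 := Real.exp_pos (u τ)
  have h1 := exp_u_mul_deriv_u_le (h.energy_eq_sq ha hζ hζ' hτ)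
  have hV := (h.abs_V_le ha hζ hζ' hτ).trans
      (Real.exp_le_exp.2 (two_mul_mul_le (k := k) hζ hζ' hτ).2)
  have h2 : |V k ζ v τ| * Real.tanh τ ≤ Real.exp (u τ) / c := by
    rw [le_div_iff₀ hc0]
    calc |V k ζ v τ| * Real.tanh τ * c
        ≤ Real.exp (((k : ℝ) + 1) * τ) * min τ 1 * c := by gcongr
      _ ≤ _ := by linarith
  have h3 : deriv u τ * Real.tanh τ ≤ ((k : ℝ) + 1) + 2 / c := by
    refine le_of_mul_le_mul_left ?_ hy0
    calc Real.exp (u τ) * (deriv u τ * Real.tanh τ)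
        = Real.exp (u τ) * deriv u τ * Real.tanh τ := by ring
      _ ≤ (((k : ℝ) + 1) * Real.exp (u τ) + 2 * |V k ζ v τ|) * Real.tanh τ := by gcongr
      _ = ((k : ℝ) + 1) * Real.exp (u τ) * Real.tanh τ + 2 * (|V k ζ v τ| * Real.tanh τ) := by ring
      _ ≤ ((k : ℝ) + 1) * Real.exp (u τ) * 1 + 2 * (Real.exp (u τ) / c) := by
          gcongr
          exact tanh_le_one
      _ = _ := by ring
  have h4 : 0 ≤ 2 / c := by positivity
  rw [abs_le]
  constructor <;> nlinarith [mul_nonneg hg hT0]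

/-- The equation for `v` in the form `(e^{-2u} v')' = 4 e^{-2u} V (u' tanh τ - (k + 1))` is
integrated from infinity. -/
theorem IsSolution.abs_deriv_v_le {τ : ℝ} (hτ : 0 < τ) :
    |deriv v τ| ≤ boundConst k * (τ + τ ^ 2) * Real.exp (2 * ζ * ((k : ℝ) + 1) * τ) := by
  have hk : (0 : ℝ) < k + 1 := by positivity
  set c := Real.exp (-2 * ((k : ℝ) + 1)) / 2 with hc
  have hc0 : 0 < c := by positivity
  set b := 2 * ((k : ℝ) + 1) + 2 / c with hb
  have hb0 : 0 < b := by positivity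
  set M := 4 * b / c ^ 2 with hM
  have hM0 : 0 < M := by positivity
  set K := 2 * ζ * ((k : ℝ) + 1) with hK
  set L := 2 * ((k : ℝ) + 1) - K with hL
  have hL1 : 1 ≤ L := by
    have h1 := (two_mul_mul_le (k := k) hζ hζ' one_pos).2
    have h2 : (0 : ℝ) ≤ k := Nat.cast_nonneg k
    linarith
  have hexp : ∀ x : ℝ, HasDerivAt (fun x => Real.exp (-(L * x))) (Real.exp (-(L * x)) * -L) x :=
    fun x => by simpa using ((hasDerivAt_id x).const_mul L).neg.exp
  have hΨ : ∀ x ∈ Ioi (0 : ℝ), HasDerivAt (fun x => M * ((1 + x⁻¹) * Real.exp (-(L * x))))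
      (M * (-(x ^ 2)⁻¹ * Real.exp (-(L * x)) + (1 + x⁻¹) * (Real.exp (-(L * x)) * -L))) x :=
    fun x hx => (((hasDerivAt_inv (ne_of_gt hx)).const_add 1).mul (hexp x)).const_mul M
  have hQ : ∀ x ∈ Ioi (0 : ℝ),
      |4 * Real.exp (-2 * u x) * V k ζ v x * (deriv u x * Real.tanh x - ((k : ℝ) + 1))| ≤
        -(M * (-(x ^ 2)⁻¹ * Real.exp (-(L * x)) + (1 + x⁻¹) * (Real.exp (-(L * x)) * -L))) := by
    intro x hx
    have hx0 : 0 < x := hx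
    have h1 := h.abs_deriv_u_mul_tanh_sub_le ha hζ hζ' hx0
    rw [← hc, ← hb] at h1
    have h2 := h.abs_V_le ha hζ hζ' hx0
    have h3 := h.le_exp_u ha hζ hζ' hx0
    rw [← hc] at h3
    have hm0 : 0 < min x 1 := lt_min hx0 one_pos
    have h4 : Real.exp (-2 * u x) ≤
        (1 + (x ^ 2)⁻¹) / c ^ 2 * Real.exp (-(2 * ((k : ℝ) + 1) * x)) := by
      have h5 : Real.exp (-(2 * ((k : ℝ) + 1) * x)) = (Real.exp (((k : ℝ) + 1) * x) ^ 2)⁻¹ := by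
        rw [← exp_neg_two_mul_eq]
        ring_nf
      rw [exp_neg_two_mul_eq, h5]
      have h6 : ((min x 1) ^ 2)⁻¹ ≤ 1 + (x ^ 2)⁻¹ := by
        have h7 : 0 < (x ^ 2)⁻¹ := by positivity
        rcases le_total x 1 with h8 | h8
        · rw [min_eq_left h8]
          linarith
        · rw [min_eq_right h8]
          rw [one_pow, inv_one]
          linarith
      calc (Real.exp (u x) ^ 2)⁻¹
          ≤ ((c * min x 1 * Real.exp (((k : ℝ) + 1) * x)) ^ 2)⁻¹ := by gcongr
        _ = ((min x 1) ^ 2)⁻¹ / c ^ 2 * (Real.exp (((k : ℝ) + 1) * x) ^ 2)⁻¹ := by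
          field_simp
        _ ≤ _ := by gcongr
    have h5 : Real.exp (-(L * x)) = Real.exp (-(2 * ((k : ℝ) + 1) * x)) * Real.exp (K * x) := by
      rw [← Real.exp_add, hL]
      ring_nf
    have h6 : 0 ≤ (L - 1 + L * x⁻¹) * Real.exp (-(L * x)) := by
      have : 0 < x⁻¹ := inv_pos.2 hx0
      have : 0 ≤ L * x⁻¹ := by positivity
      exact mul_nonneg (by linarith) (Real.exp_pos _).le
    rw [abs_mul, abs_mul, abs_mul, Real.abs_exp, abs_of_pos (four_pos : (0 : ℝ) < 4)]
    calc 4 * Real.exp (-2 * u x) * |V k ζ v x| * |deriv u x * Real.tanh x - ((k : ℝ) + 1)|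
        ≤ 4 * ((1 + (x ^ 2)⁻¹) / c ^ 2 * Real.exp (-(2 * ((k : ℝ) + 1) * x))) *
          Real.exp (K * x) * b := by gcongr
      _ = M * ((1 + (x ^ 2)⁻¹) * Real.exp (-(L * x))) := by rw [h5, hM]; ring
      _ ≤ M * ((1 + (x ^ 2)⁻¹) * Real.exp (-(L * x)) +
          (L - 1 + L * x⁻¹) * Real.exp (-(L * x))) := by gcongr; linarith
      _ = _ := by ring
  -- the bound holds at infinity along a sequence, and the two differences are monotone
  obtain ⟨s, hs, hsq⟩ := h.exists_seq_tendsto ha hζ hζ'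
  have hQlim : Tendsto (fun n => Real.exp (-2 * u (s n)) * deriv v (s n)) atTop (𝓝 0) := by
    have h1 := ((h.tendsto_exp_neg_u ha hζ hζ').comp hs).mul hsq
    rw [zero_mul] at h1
    refine h1.congr fun n => ?_
    rw [Function.comp_apply, ← mul_assoc, ← Real.exp_add]
    ring_nf
  have hΨlim : Tendsto (fun n => M * ((1 + (s n)⁻¹) * Real.exp (-(L * s n)))) atTop (𝓝 0) := by
    have h1 : Tendsto (fun n => Real.exp (-(L * s n))) atTop (𝓝 0) :=
      Real.tendsto_exp_neg_atTop_nhds_zero.comp (hs.const_mul_atTop (by linarith))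
    have h2 := (((tendsto_inv_atTop_zero.comp hs).const_add 1).mul h1).const_mul M
    simpa using h2
  have hge : ∀ f f' : ℝ → ℝ, (∀ x ∈ Ioi (0 : ℝ), HasDerivAt f (f' x) x) →
      (∀ x ∈ Ioi (0 : ℝ), f' x ≤ 0) → Tendsto (fun n => f (s n)) atTop (𝓝 0) → 0 ≤ f τ := by
    intro f f' hf hf' hlim
    refine le_of_tendsto hlim ?_
    filter_upwards [hs.eventually_ge_atTop τ] with n hn
    exact antitoneOn_of_hasDerivAt_nonpos (convex_Ioi 0) hf hf' hτ (hτ.trans_le hn) hn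
  have h1 := hge _ _ (fun x hx => (hΨ x hx).sub (h.hasDerivAt_exp_mul_deriv_v hx))
    (fun x hx => by linarith [(abs_le.1 (hQ x hx)).1])
    (by have := hΨlim.sub hQlim; rwa [sub_zero] at this)
  have h2 := hge _ _ (fun x hx => (hΨ x hx).add (h.hasDerivAt_exp_mul_deriv_v hx))
    (fun x hx => by linarith [(abs_le.1 (hQ x hx)).2])
    (by have := hΨlim.add hQlim; rwa [add_zero] at this)
  simp only [Pi.sub_apply, Pi.add_apply] at h1 h2
  have h3 : Real.exp (-2 * u τ) * |deriv v τ| ≤ M * ((1 + τ⁻¹) * Real.exp (-(L * τ))) := by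
    rw [← abs_of_pos (Real.exp_pos (-2 * u τ)), ← abs_mul]
    rw [abs_le]
    constructor <;> linarith
  rw [exp_neg_two_mul_eq, inv_mul_le_iff₀ (by positivity)] at h3
  have h4 : boundConst k = 4 * M := by rw [hM, hb, hc, boundConst]
  rw [h4]
  refine h3.trans ?_
  have h5 := h.exp_u_le ha hζ hζ' hτ
  have h6 : Real.exp (((k : ℝ) + 1) * τ) ^ 2 * Real.exp (-(L * τ)) = Real.exp (K * τ) := by
    rw [← Real.exp_nat_mul, ← Real.exp_add, hL]
    push_cast
    ring_nf
  calc Real.exp (u τ) ^ 2 * (M * ((1 + τ⁻¹) * Real.exp (-(L * τ))))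
      ≤ (2 * τ * Real.exp (((k : ℝ) + 1) * τ)) ^ 2 * (M * ((1 + τ⁻¹) * Real.exp (-(L * τ)))) := by
        gcongr
    _ = 4 * M * (τ ^ 2 * (1 + τ⁻¹)) *
        (Real.exp (((k : ℝ) + 1) * τ) ^ 2 * Real.exp (-(L * τ))) := by ring
    _ = _ := by
      rw [h6]
      field_simp
      ring

theorem IsSolution.abs_v_le {τ : ℝ} (hτ : 0 < τ) :
    |v τ| ≤ boundConst k * (τ ^ 2 + τ ^ 3) * Real.exp (2 * ζ * ((k : ℝ) + 1) * τ) := by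
  set K := 2 * ζ * ((k : ℝ) + 1) with hK
  have hK0 : 0 ≤ K := by positivity
  have hC := boundConst_pos k
  -- the derivative of `C (τ² + τ³) e^{K τ}` dominates the bound for `v'`
  refine abs_le_of_abs_hasDerivAt_le (c := τ + 1)
    (b := fun τ => boundConst k * (τ ^ 2 + τ ^ 3) * Real.exp (K * τ))
    (fun x hx => h.hasDerivAt_v hx.1)
    (fun x _ => (((hasDerivAt_pow 2 x).add (hasDerivAt_pow 3 x)).const_mul (boundConst k)).mul
      (((hasDerivAt_id x).const_mul K).exp)) (fun x hx => ?_) ha.tendsto_v_zero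
    (((by fun_prop : Continuous fun τ => boundConst k * (τ ^ 2 + τ ^ 3) *
      Real.exp (K * τ)).tendsto' 0 0 (by simp)).mono_left nhdsWithin_le_nhds)
    τ ⟨hτ, by linarith⟩
  refine (h.abs_deriv_v_le ha hζ hζ' hx.1).trans ?_
  have hx0 := hx.1
  have h1 : 0 ≤ boundConst k * (x + 2 * x ^ 2 + (x ^ 2 + x ^ 3) * K) * Real.exp (K * x) := by
    positivity
  simp only [id, Pi.add_apply]
  norm_num
  linarith

theorem IsSolution.aprioriBounds : AprioriBounds k (boundConst k) ζ u v where
  energy_eq _ hτ := h.energy_eq_sq ha hζ hζ' hτ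
  le_deriv_u _ hτ := h.le_deriv_u ha hζ hζ' hτ
  exp_u_le _ hτ := h.exp_u_le ha hζ hζ' hτ
  le_exp_u _ hτ := h.le_exp_u ha hζ hζ' hτ
  abs_V_le _ hτ := h.abs_V_le ha hζ hζ' hτ
  abs_deriv_v_le _ hτ := h.abs_deriv_v_le ha hζ hζ' hτ
  abs_v_le _ hτ := h.abs_v_le ha hζ hζ' hτ

end VelocityBound

/-! ### Regular coordinates at the singular point -/

/-- The right-hand sides of the system at the singular point `τ = 0`, in the coordinates
`(θ, α, δ, β, η, v)` of `singularCoords`; `z` stands for `ζ` and `t` for `τ`. The system reads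
`(τ θ)' = F₀`, `α' = F₁`, `2 δ = F₂`, `(τ³ β)' = τ² F₃`, `η' = F₄`, `v' = F₅`. -/
def singularField (k : ℕ) {A : Type*} [CommRing A] (z t : A) (x : Fin 6 → A) : Fin 6 → A :=
  ![1 - t ^ 2 * x 0 ^ 2,
    (x 3 + x 2 - 2 * z ^ 2 * (k + 1) * x 0) * (2 * k + 1 + t * x 1) - (2 * k + 1) * x 3 +
      (2 * (k + 1) * z ^ 2 - 1) * x 0 ^ 2 * (1 + t ^ 2 * x 3),
    (k + 1) ^ 2 - z ^ 2 * (2 * k + 1 + t * x 1 - x 0 * (1 + t ^ 2 * x 3)) ^ 2 -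
      t ^ 2 * (x 3 + x 2) ^ 2 + t ^ 2 * x 3 ^ 2,
    -x 2 + 2 * z ^ 2 * (k + 1) * x 0 -
      t ^ 2 * x 3 * (x 3 + x 2 - 2 * z ^ 2 * (k + 1) * x 0) -
      2 * z ^ 2 * (k + 1) * (2 * k + 1 + t * x 1),
    t * (x 3 + x 2) * x 4,
    t * x 4 * (2 * k + 1 + t * x 1 - x 0 * (1 + t ^ 2 * x 3))]

theorem map_singularField (k : ℕ) {A B : Type*} [CommRing A] [CommRing B] (f : A →+* B) (z t : A)
    (x : Fin 6 → A) (i : Fin 6) :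
    f (singularField k z t x i) = singularField k (f z) (f t) (fun j => f (x j)) i := by
  have h2 : f 2 = 2 := map_ofNat f 2
  fin_cases i <;> simp [singularField, h2]

/-- Coordinates in which a solution is regular at `τ = 0`: they are defined by
`tanh τ = τ θ`, `e^{-u} (v' + 2 V tanh τ) = 2 k + 1 + τ α`, `2 e^{-u} V = 1 / τ + τ β`,
`u' = 1 / τ + τ (β + δ)`, `e^u = τ η`, and `v` itself. -/
noncomputable def singularCoords (k : ℕ) (ζ : ℝ) (u v : ℝ → ℝ) (τ : ℝ) : Fin 6 → ℝ :=
  ![Real.tanh τ / τ,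
    ((deriv v τ + 2 * V k ζ v τ * Real.tanh τ) / Real.exp (u τ) - (2 * k + 1)) / τ,
    (deriv u τ - 2 * V k ζ v τ / Real.exp (u τ)) / τ,
    (2 * V k ζ v τ / Real.exp (u τ) - 1 / τ) / τ,
    Real.exp (u τ) / τ,
    v τ]

section SingularCoords

variable {k : ℕ} {ζ : ℝ} {u v : ℝ → ℝ} {τ : ℝ}

theorem hasDerivAt_singularCoords_zero (hτ : 0 < τ) :
    HasDerivAt (fun τ => τ ^ (0 + 1) * singularCoords k ζ u v τ 0)
      (τ ^ 0 * singularField k ζ τ (singularCoords k ζ u v τ) 0) τ := by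
  have h1 := hasDerivAt_tanh τ
  have h2 : (fun τ => τ ^ (0 + 1) * singularCoords k ζ u v τ 0) =ᶠ[𝓝 τ] Real.tanh := by
    filter_upwards [Ioi_mem_nhds hτ] with σ hσ
    have := ne_of_gt (mem_Ioi.1 hσ)
    simp only [singularCoords, Matrix.cons_val_zero]
    field_simp
    ring
  refine (h1.congr_of_eventuallyEq h2).congr_deriv ?_
  simp only [singularField, singularCoords, Matrix.cons_val_zero]
  field_simp

theorem IsSolution.hasDerivAt_singularCoords_one (h : IsSolution k ζ u v) (hτ : 0 < τ) :
    HasDerivAt (fun τ => singularCoords k ζ u v τ 1)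
      (singularField k ζ τ (singularCoords k ζ u v τ) 1) τ := by
  have hy := (Real.exp_pos (u τ)).ne'
  have h1 := ((((h.eq_v τ hτ).add (((h.hasDerivAt_V hτ).const_mul 2).mul (hasDerivAt_tanh τ))).div
    (h.hasDerivAt_exp_u hτ) hy).sub_const (2 * (k : ℝ) + 1)).div (hasDerivAt_id τ) hτ.ne'
  refine h1.congr_deriv ?_
  simp only [singularField, singularCoords, Pi.add_apply, Pi.mul_apply, Pi.div_apply, id,
    Matrix.cons_val]
  field_simp
  ring

theorem two_mul_singularCoords_two (he : energy k ζ u v τ = ((k : ℝ) + 1) ^ 2) (hτ : 0 < τ) :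
    2 * singularCoords k ζ u v τ 2 = singularField k ζ τ (singularCoords k ζ u v τ) 2 := by
  have hy := (Real.exp_pos (u τ)).ne'
  rw [energy, exp_neg_two_mul_eq] at he
  simp only [singularField, singularCoords, Matrix.cons_val]
  rw [← he]
  field_simp
  ring

theorem IsSolution.hasDerivAt_singularCoords_three (h : IsSolution k ζ u v) (hτ : 0 < τ) :
    HasDerivAt (fun τ => τ ^ (2 + 1) * singularCoords k ζ u v τ 3)
      (τ ^ 2 * singularField k ζ τ (singularCoords k ζ u v τ) 3) τ := by
  have hy := (Real.exp_pos (u τ)).ne'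
  have h1 := (((hasDerivAt_pow 2 τ).mul (((h.hasDerivAt_V hτ).const_mul 2).div
    (h.hasDerivAt_exp_u hτ) hy)).sub (hasDerivAt_id τ))
  have h2 : (fun τ => τ ^ (2 + 1) * singularCoords k ζ u v τ 3) =ᶠ[𝓝 τ]
      ((fun τ => τ ^ 2) * ((fun τ => 2 * V k ζ v τ) / fun τ => Real.exp (u τ))) - id := by
    filter_upwards [Ioi_mem_nhds hτ] with σ hσ
    have := ne_of_gt (mem_Ioi.1 hσ)
    have := (Real.exp_pos (u σ)).ne'
    simp only [singularCoords, Matrix.cons_val, Pi.sub_apply, Pi.mul_apply, Pi.div_apply, id]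
    field_simp
  refine (h1.congr_of_eventuallyEq h2).congr_deriv ?_
  simp only [singularField, singularCoords, Pi.div_apply, Matrix.cons_val]
  push_cast
  field_simp
  ring

theorem IsSolution.hasDerivAt_singularCoords_four (h : IsSolution k ζ u v) (hτ : 0 < τ) :
    HasDerivAt (fun τ => singularCoords k ζ u v τ 4)
      (singularField k ζ τ (singularCoords k ζ u v τ) 4) τ := by
  have hy := (Real.exp_pos (u τ)).ne'
  refine ((h.hasDerivAt_exp_u hτ).div (hasDerivAt_id τ) hτ.ne').congr_deriv ?_
  simp only [singularField, singularCoords, id, Matrix.cons_val]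
  field_simp
  ring

theorem IsSolution.hasDerivAt_singularCoords_five (h : IsSolution k ζ u v) (hτ : 0 < τ) :
    HasDerivAt (fun τ => singularCoords k ζ u v τ 5)
      (singularField k ζ τ (singularCoords k ζ u v τ) 5) τ := by
  have hy := (Real.exp_pos (u τ)).ne'
  refine (h.hasDerivAt_v hτ).congr_deriv ?_
  simp only [singularField, singularCoords, Matrix.cons_val]
  field_simp
  ring

theorem IsSolution.continuousAt_singularCoords (h : IsSolution k ζ u v) (hτ : 0 < τ) :
    ContinuousAt (singularCoords k ζ u v) τ := by
  have hy := (Real.exp_pos (u τ)).ne'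
  have h1 := (h.hasDerivAt_u hτ).continuousAt
  have h2 := (h.hasDerivAt_v hτ).continuousAt
  have h3 := (h.eq_u τ hτ).continuousAt
  have h4 := (h.eq_v τ hτ).continuousAt
  have h5 := (h.hasDerivAt_V hτ).continuousAt
  have h6 := (hasDerivAt_tanh τ).continuousAt
  have h7 : ContinuousAt (fun τ => Real.exp (u τ)) τ := (h.hasDerivAt_exp_u hτ).continuousAt
  have hτ0 := hτ.ne'
  rw [continuousAt_pi]
  intro i
  fin_cases i <;> simp only [singularCoords] <;> simp <;> fun_prop (disch := assumption)

end SingularCoords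

/-! ### Behaviour of a solution at the singular point -/

/-- Integration of an order of vanishing at `0`. -/
theorem isBigO_of_hasDerivAt {f f' : ℝ → ℝ} {n : ℕ} (hf : ∀ x, 0 < x → HasDerivAt f (f' x) x)
    (h : f' =O[𝓝[>] 0] fun x : ℝ => x ^ n) (h0 : Tendsto f (𝓝[>] 0) (𝓝 0)) :
    f =O[𝓝[>] 0] fun x : ℝ => x ^ (n + 1) := by
  obtain ⟨C, hC0, hC⟩ := h.exists_nonneg
  obtain ⟨c, hc, hmem⟩ := mem_nhdsGT_iff_exists_Ioo_subset.1 hC.bound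
  have hc0 : (0 : ℝ) < c := hc
  have hb : ∀ x, HasDerivAt (fun x : ℝ => C * x ^ (n + 1)) (C * ((n + 1) * x ^ n)) x := fun x => by
    have := (hasDerivAt_pow (n + 1) x).const_mul C
    simpa using this
  have hle := abs_le_of_abs_hasDerivAt_le (fun x (hx : x ∈ Ioo 0 c) => hf x hx.1)
    (fun x _ => hb x) (fun x hx => by
      have h1 : ‖f' x‖ ≤ C * ‖x ^ n‖ := hmem hx
      rw [Real.norm_eq_abs, Real.norm_eq_abs, abs_of_nonneg (pow_nonneg hx.1.le n)] at h1
      have h2 : 0 ≤ C * (n * x ^ n) := by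
        have := hx.1
        positivity
      linarith) h0
    (((by fun_prop : Continuous fun x : ℝ => C * x ^ (n + 1)).tendsto' 0 0
      (by simp)).mono_left nhdsWithin_le_nhds)
  refine IsBigO.of_bound C ?_
  filter_upwards [Ioo_mem_nhdsGT hc0] with x hx
  rw [Real.norm_eq_abs, Real.norm_eq_abs, abs_of_nonneg (pow_nonneg hx.1.le (n + 1))]
  exact hle x hx

/-- A function on `(0, ∞)` with bounded derivative near `0` has a limit at `0`. -/
theorem exists_tendsto_of_hasDerivAt_isBigO_one {f f' : ℝ → ℝ}
    (hf : ∀ x, 0 < x → HasDerivAt f (f' x) x) (h : f' =O[𝓝[>] 0] fun _ : ℝ => (1 : ℝ)) :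
    ∃ L, Tendsto f (𝓝[>] 0) (𝓝 L) := by
  obtain ⟨C, hC0, hC⟩ := h.exists_nonneg
  obtain ⟨c, hc, hmem⟩ := mem_nhdsGT_iff_exists_Ioo_subset.1 hC.bound
  have hc0 : (0 : ℝ) < c := hc
  have hlip : LipschitzOnWith C.toNNReal f (Ioo 0 c) :=
    (convex_Ioo 0 c).lipschitzOnWith_of_nnnorm_hasDerivWithin_le
      (fun x hx => (hf x hx.1).hasDerivWithinAt) (fun x hx => by
        have h1 : ‖f' x‖ ≤ C * ‖(1 : ℝ)‖ := hmem hx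
        rw [norm_one, mul_one] at h1
        rw [← NNReal.coe_le_coe, coe_nnnorm]
        exact h1.trans (Real.le_coe_toNNReal C))
  have hcau : Cauchy (map f (𝓝[Ioo 0 c] 0)) := by
    refine Cauchy.map_of_le ?_ hlip.uniformContinuousOn (le_principal_iff.2 self_mem_nhdsWithin)
    have : (𝓝[Ioo 0 c] (0 : ℝ)).NeBot := by
      rw [nhdsWithin_Ioo_eq_nhdsGT hc0]
      infer_instance
    exact cauchy_nhds.mono nhdsWithin_le_nhds
  rw [nhdsWithin_Ioo_eq_nhdsGT hc0] at hcau
  exact cauchy_map_iff_exists_tendsto.1 hcau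

theorem isBigO_one_div {f g : ℝ → ℝ} {l : Filter ℝ} (h : f =O[l] g) :
    (fun x => f x / g x) =O[l] fun _ => (1 : ℝ) := by
  obtain ⟨C, hC0, hC⟩ := h.exists_nonneg
  refine IsBigO.of_bound C ?_
  filter_upwards [hC.bound] with x hx
  rw [norm_one, mul_one, norm_div]
  exact div_le_of_le_mul₀ (norm_nonneg _) hC0 hx

theorem tendsto_zero_mul_of_isBigO_one {f g : ℝ → ℝ} {l : Filter ℝ} (hf : Tendsto f l (𝓝 0))
    (hg : g =O[l] fun _ => (1 : ℝ)) : Tendsto (fun x => f x * g x) l (𝓝 0) := by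
  have h1 : (fun x => f x * g x) =O[l] fun x => f x * 1 := (isBigO_refl f l).mul hg
  simp only [mul_one] at h1
  exact h1.trans_tendsto hf

section SingularLimit

variable {k : ℕ} {C ζ : ℝ} {u v : ℝ → ℝ}

theorem tendsto_id_nhdsGT_zero : Tendsto (fun τ : ℝ => τ) (𝓝[>] 0) (𝓝 0) :=
  tendsto_id'.2 nhdsWithin_le_nhds

theorem tendsto_pow_nhdsGT_zero {n : ℕ} (hn : n ≠ 0) :
    Tendsto (fun τ : ℝ => τ ^ n) (𝓝[>] 0) (𝓝 0) := by
  simpa [hn] using tendsto_id_nhdsGT_zero.pow n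

theorem tendsto_tanh_div : Tendsto (fun τ => Real.tanh τ / τ) (𝓝[>] 0) (𝓝 1) := by
  have h1 := hasDerivAt_iff_tendsto_slope.1 (hasDerivAt_tanh 0)
  rw [Real.tanh_zero] at h1
  have h2 := h1.mono_left (nhdsWithin_mono 0 fun x (hx : x ∈ Ioi 0) => ne_of_gt hx)
  norm_num at h2
  refine h2.congr fun x => ?_
  simp [slope_def_field]

theorem AprioriBounds.exp_u_isBigO (hb : AprioriBounds k C ζ u v) :
    (fun τ => Real.exp (u τ)) =O[𝓝[>] 0] fun τ : ℝ => τ := by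
  have hk : (0 : ℝ) < k + 1 := by positivity
  refine IsBigO.of_bound (2 * Real.exp ((k : ℝ) + 1)) ?_
  filter_upwards [Ioo_mem_nhdsGT one_pos] with τ hτ
  rw [Real.norm_of_nonneg (Real.exp_pos _).le, Real.norm_of_nonneg hτ.1.le]
  have h0 := hτ.1
  calc Real.exp (u τ) ≤ 2 * τ * Real.exp (((k : ℝ) + 1) * τ) := hb.exp_u_le τ hτ.1
    _ ≤ 2 * τ * Real.exp (((k : ℝ) + 1) * 1) := by gcongr; exact hτ.2.le
    _ = _ := by rw [mul_one]; ring

theorem AprioriBounds.isBigO_exp_u (hb : AprioriBounds k C ζ u v) :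
    (fun τ : ℝ => τ) =O[𝓝[>] 0] fun τ => Real.exp (u τ) := by
  have hk : (0 : ℝ) < k + 1 := by positivity
  refine IsBigO.of_bound (Real.exp (-2 * ((k : ℝ) + 1)) / 2)⁻¹ ?_
  filter_upwards [Ioo_mem_nhdsGT one_pos] with τ hτ
  rw [Real.norm_of_nonneg (Real.exp_pos _).le, Real.norm_of_nonneg hτ.1.le]
  rw [inv_mul_eq_div, le_div_iff₀ (by positivity)]
  have h1 := hb.le_exp_u τ hτ.1
  rw [min_eq_left hτ.2.le] at h1
  have h2 : 1 ≤ Real.exp (((k : ℝ) + 1) * τ) := Real.one_le_exp (mul_nonneg hk.le hτ.1.le)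
  refine le_trans ?_ h1
  have h0 := hτ.1
  have h3 : 0 ≤ Real.exp (-2 * ((k : ℝ) + 1)) / 2 * τ := by positivity
  nlinarith

theorem AprioriBounds.deriv_v_isBigO (hb : AprioriBounds k C ζ u v) (hζ : 0 ≤ ζ)
    (hζ' : ζ < 1 / 2) : deriv v =O[𝓝[>] 0] fun τ : ℝ => τ := by
  refine IsBigO.of_bound (|C| * 2 * Real.exp ((k : ℝ) + 1)) ?_
  filter_upwards [Ioo_mem_nhdsGT one_pos] with τ hτ
  have h0 := hτ.1
  rw [Real.norm_eq_abs, Real.norm_of_nonneg hτ.1.le]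
  have hexp : Real.exp (2 * ζ * ((k : ℝ) + 1) * τ) ≤ Real.exp (((k : ℝ) + 1) * 1) :=
    Real.exp_le_exp.2 ((two_mul_mul_le (k := k) hζ hζ' h0).2.trans
      (by gcongr; exact hτ.2.le))
  rw [mul_one] at hexp
  calc |deriv v τ| ≤ C * (τ + τ ^ 2) * Real.exp (2 * ζ * ((k : ℝ) + 1) * τ) :=
        hb.abs_deriv_v_le τ h0
    _ ≤ |C| * (τ + τ) * Real.exp ((k : ℝ) + 1) := by
        gcongr
        · exact le_abs_self C
        · nlinarith [hτ.2]
    _ = _ := by ring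

theorem AprioriBounds.v_isBigO (hb : AprioriBounds k C ζ u v) (hζ : 0 ≤ ζ)
    (hζ' : ζ < 1 / 2) : v =O[𝓝[>] 0] fun τ : ℝ => τ ^ 2 := by
  refine IsBigO.of_bound (|C| * 2 * Real.exp ((k : ℝ) + 1)) ?_
  filter_upwards [Ioo_mem_nhdsGT one_pos] with τ hτ
  have h0 := hτ.1
  rw [Real.norm_eq_abs, Real.norm_of_nonneg (sq_nonneg τ)]
  have hexp : Real.exp (2 * ζ * ((k : ℝ) + 1) * τ) ≤ Real.exp (((k : ℝ) + 1) * 1) :=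
    Real.exp_le_exp.2 ((two_mul_mul_le (k := k) hζ hζ' h0).2.trans
      (by gcongr; exact hτ.2.le))
  rw [mul_one] at hexp
  calc |v τ| ≤ C * (τ ^ 2 + τ ^ 3) * Real.exp (2 * ζ * ((k : ℝ) + 1) * τ) :=
        hb.abs_v_le τ h0
    _ ≤ |C| * (τ ^ 2 + τ ^ 2) * Real.exp ((k : ℝ) + 1) := by
        gcongr ?_ * (_ + ?_) * ?_
        · exact le_abs_self C
        · nlinarith [hτ.2, sq_nonneg τ]
    _ = _ := by ring

theorem AprioriBounds.V_sub_one_isBigO (hb : AprioriBounds k C ζ u v) (hζ : 0 ≤ ζ)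
    (hζ' : ζ < 1 / 2) : (fun τ => V k ζ v τ - 1) =O[𝓝[>] 0] fun τ : ℝ => τ ^ 2 := by
  refine ((hb.v_isBigO hζ hζ').const_mul_left (-(ζ ^ 2 * ((k : ℝ) + 1)))).congr_left fun τ => ?_
  rw [V]
  ring

theorem pow_isBigO_one (n : ℕ) : (fun τ : ℝ => τ ^ n) =O[𝓝[>] 0] fun _ => (1 : ℝ) :=
  ((continuous_pow n).tendsto (0 : ℝ) |>.mono_left nhdsWithin_le_nhds).isBigO_one ℝ

theorem AprioriBounds.V_isBigO_one (hb : AprioriBounds k C ζ u v) (hζ : 0 ≤ ζ)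
    (hζ' : ζ < 1 / 2) : V k ζ v =O[𝓝[>] 0] fun _ => (1 : ℝ) := by
  have h1 := ((hb.V_sub_one_isBigO hζ hζ').trans (pow_isBigO_one 2)).add
    (isBigO_refl (fun _ : ℝ => (1 : ℝ)) _)
  exact h1.congr_left fun τ => by ring

/-- By the conservation law, the slope of `e^u` at `0` is `2`, up to second order. -/
theorem AprioriBounds.deriv_exp_u_sub_two_isBigO (hb : AprioriBounds k C ζ u v) (hζ : 0 ≤ ζ)
    (hζ' : ζ < 1 / 2) :
    (fun τ => Real.exp (u τ) * deriv u τ - 2) =O[𝓝[>] 0] fun τ : ℝ => τ ^ 2 := by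
  have hk : (0 : ℝ) < k + 1 := by positivity
  have h1 : (fun τ => (Real.exp (u τ) * deriv u τ) ^ 2 - 4) =O[𝓝[>] 0] fun τ : ℝ => τ ^ 2 := by
    have hV1 : (fun τ => (V k ζ v τ - 1) * (V k ζ v τ + 1)) =O[𝓝[>] 0] fun τ : ℝ => τ ^ 2 * 1 :=
      (hb.V_sub_one_isBigO hζ hζ').mul
        ((hb.V_isBigO_one hζ hζ').add (isBigO_refl (fun _ : ℝ => (1 : ℝ)) _))
    simp only [mul_one] at hV1
    have h2 := (((hb.exp_u_isBigO.pow 2).const_mul_left (((k : ℝ) + 1) ^ 2)).add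
      (hV1.const_mul_left 4)).sub (((hb.deriv_v_isBigO hζ hζ').pow 2).const_mul_left (ζ ^ 2))
    refine h2.congr' ?_ EventuallyEq.rfl
    filter_upwards [self_mem_nhdsWithin] with τ hτ
    rw [sq_exp_u_mul_deriv_u (hb.energy_eq τ hτ)]
    ring
  refine IsBigO.trans (IsBigO.of_bound 1 ?_) h1
  filter_upwards [self_mem_nhdsWithin] with τ hτ
  have h2 : 0 ≤ Real.exp (u τ) * deriv u τ :=
    mul_nonneg (Real.exp_pos _).le (hk.le.trans (hb.le_deriv_u τ hτ))
  have h3 : (Real.exp (u τ) * deriv u τ) ^ 2 - 4 =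
      (Real.exp (u τ) * deriv u τ - 2) * (Real.exp (u τ) * deriv u τ + 2) := by ring
  rw [one_mul, h3, norm_mul]
  refine le_mul_of_one_le_right (norm_nonneg _) ?_
  rw [Real.norm_of_nonneg (by linarith)]
  linarith

variable (h : IsSolution k ζ u v) (hb : AprioriBounds k C ζ u v) (hζ : 0 ≤ ζ) (hζ' : ζ < 1 / 2)

include h hb hζ hζ'

theorem AprioriBounds.exp_u_sub_isBigO :
    (fun τ => Real.exp (u τ) - 2 * τ) =O[𝓝[>] 0] fun τ : ℝ => τ ^ 3 := by
  have h1 : Tendsto (fun τ => Real.exp (u τ) - 2 * τ) (𝓝[>] 0) (𝓝 0) := by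
    simpa using (hb.exp_u_isBigO.trans_tendsto tendsto_id_nhdsGT_zero).sub
      (tendsto_id_nhdsGT_zero.const_mul 2)
  refine isBigO_of_hasDerivAt (f' := fun τ => Real.exp (u τ) * deriv u τ - 2) (fun τ hτ => ?_)
    (hb.deriv_exp_u_sub_two_isBigO hζ hζ') h1
  exact ((h.hasDerivAt_exp_u hτ).sub ((hasDerivAt_id τ).const_mul 2)).congr_deriv (by ring)

/-- Boundedness of `β`, that is `2 e^{-u} V - 1 / τ = O(τ)`. -/
theorem AprioriBounds.singularCoords_three_isBigO_one :
    (fun τ => singularCoords k ζ u v τ 3) =O[𝓝[>] 0] fun _ => (1 : ℝ) := by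
  have h1 : (fun τ => 2 * (τ * (V k ζ v τ - 1)) - (Real.exp (u τ) - 2 * τ)) =O[𝓝[>] 0]
      fun τ : ℝ => τ ^ 3 := by
    have h2 : (fun τ => τ * (V k ζ v τ - 1)) =O[𝓝[>] 0] fun τ : ℝ => τ * τ ^ 2 :=
      (isBigO_refl _ _).mul (hb.V_sub_one_isBigO hζ hζ')
    exact ((h2.congr_right fun τ => by ring).const_mul_left 2).sub
      (hb.exp_u_sub_isBigO h hζ hζ')
  have h2 : (fun τ : ℝ => τ ^ 3) =O[𝓝[>] 0] fun τ => τ ^ 2 * Real.exp (u τ) :=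
    ((isBigO_refl (fun τ : ℝ => τ ^ 2) _).mul hb.isBigO_exp_u).congr_left fun τ => by ring
  refine (isBigO_one_div (h1.trans h2)).congr' ?_ EventuallyEq.rfl
  filter_upwards [self_mem_nhdsWithin] with τ hτ
  have := ne_of_gt (mem_Ioi.1 hτ)
  have := (Real.exp_pos (u τ)).ne'
  simp only [singularCoords, Matrix.cons_val]
  field_simp
  ring

/-- Boundedness of `β + δ`, that is `u' - 1 / τ = O(τ)`. -/
theorem AprioriBounds.singularCoords_add_isBigO_one :
    (fun τ => singularCoords k ζ u v τ 3 + singularCoords k ζ u v τ 2) =O[𝓝[>] 0]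
      fun _ => (1 : ℝ) := by
  have h1 : (fun τ => τ * (Real.exp (u τ) * deriv u τ - 2) - (Real.exp (u τ) - 2 * τ)) =O[𝓝[>] 0]
      fun τ : ℝ => τ ^ 3 := by
    have h2 : (fun τ => τ * (Real.exp (u τ) * deriv u τ - 2)) =O[𝓝[>] 0] fun τ : ℝ => τ * τ ^ 2 :=
      (isBigO_refl _ _).mul (hb.deriv_exp_u_sub_two_isBigO hζ hζ')
    exact (h2.congr_right fun τ => by ring).sub (hb.exp_u_sub_isBigO h hζ hζ')
  have h2 : (fun τ : ℝ => τ ^ 3) =O[𝓝[>] 0] fun τ => τ ^ 2 * Real.exp (u τ) :=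
    ((isBigO_refl (fun τ : ℝ => τ ^ 2) _).mul hb.isBigO_exp_u).congr_left fun τ => by ring
  refine (isBigO_one_div (h1.trans h2)).congr' ?_ EventuallyEq.rfl
  filter_upwards [self_mem_nhdsWithin] with τ hτ
  have := ne_of_gt (mem_Ioi.1 hτ)
  have := (Real.exp_pos (u τ)).ne'
  simp only [singularCoords, Matrix.cons_val]
  field_simp
  ring

omit h in
/-- Boundedness of `2 k + 1 + τ α = e^{-u} (v' + 2 V tanh τ)`; that of `α` itself follows only from
its differential equation. -/
theorem AprioriBounds.singularCoords_one_isBigO_one :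
    (fun τ => 2 * (k : ℝ) + 1 + τ * singularCoords k ζ u v τ 1) =O[𝓝[>] 0] fun _ => (1 : ℝ) := by
  have hT : Real.tanh =O[𝓝[>] 0] fun τ : ℝ => τ := by
    refine (hasDerivAt_tanh 0).isBigO_sub.mono nhdsWithin_le_nhds |>.congr ?_ ?_ <;> simp
  have h1 : (fun τ => deriv v τ + 2 * (V k ζ v τ * Real.tanh τ)) =O[𝓝[>] 0] fun τ : ℝ => τ := by
    have h2 := ((hb.V_isBigO_one hζ hζ').mul hT).const_mul_left 2
    simp only [one_mul] at h2
    exact (hb.deriv_v_isBigO hζ hζ').add h2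
  refine (isBigO_one_div (h1.trans hb.isBigO_exp_u)).congr' ?_ EventuallyEq.rfl
  filter_upwards [self_mem_nhdsWithin] with τ hτ
  have := ne_of_gt (mem_Ioi.1 hτ)
  have := (Real.exp_pos (u τ)).ne'
  simp only [singularCoords, Matrix.cons_val]
  field_simp
  ring

theorem AprioriBounds.exists_tendsto_singularCoords_one :
    ∃ α, Tendsto (fun τ => singularCoords k ζ u v τ 1) (𝓝[>] 0) (𝓝 α) := by
  refine exists_tendsto_of_hasDerivAt_isBigO_one
    (fun τ hτ => h.hasDerivAt_singularCoords_one hτ) ?_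
  have mul : ∀ {f g : ℝ → ℝ}, f =O[𝓝[>] 0] (fun _ => (1 : ℝ)) → g =O[𝓝[>] 0] (fun _ => (1 : ℝ)) →
      (fun x => f x * g x) =O[𝓝[>] 0] fun _ => (1 : ℝ) := fun hf hg =>
    (hf.mul hg).congr_right fun _ => mul_one 1
  have hθ : (fun τ => singularCoords k ζ u v τ 0) =O[𝓝[>] 0] fun _ => (1 : ℝ) :=
    tendsto_tanh_div.isBigO_one ℝ
  have hβ := hb.singularCoords_three_isBigO_one h hζ hζ'
  have hγ := hb.singularCoords_add_isBigO_one h hζ hζ'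
  have hα := hb.singularCoords_one_isBigO_one hζ hζ'
  exact ((mul (hγ.sub (hθ.const_mul_left (2 * ζ ^ 2 * ((k : ℝ) + 1)))) hα).sub
    (hβ.const_mul_left (2 * (k : ℝ) + 1))).add
    (mul (mul (isBigO_const_const (2 * ((k : ℝ) + 1) * ζ ^ 2 - 1) one_ne_zero _)
      ((hθ.pow 2).congr_right fun _ => one_pow 2))
      ((isBigO_refl (fun _ : ℝ => (1 : ℝ)) _).add (mul (pow_isBigO_one 2) hβ)))

/-- The regular coordinates have limits at the singular point, and the free parameter of the
solution is the limit of `α`. -/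
theorem AprioriBounds.exists_tendsto_singularCoords :
    ∃ x : Fin 6 → ℝ, x 0 = 1 ∧ x 4 = 2 ∧ x 5 = 0 ∧
      Tendsto (singularCoords k ζ u v) (𝓝[>] 0) (𝓝 x) := by
  obtain ⟨α, hα⟩ := hb.exists_tendsto_singularCoords_one h hζ hζ'
  have hβ := hb.singularCoords_three_isBigO_one h hζ hζ'
  have hτ0 := tendsto_id_nhdsGT_zero
  have hτβ := tendsto_zero_mul_of_isBigO_one hτ0 hβ
  have hτγ := tendsto_zero_mul_of_isBigO_one hτ0 (hb.singularCoords_add_isBigO_one h hζ hζ')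
  have hθ : Tendsto (fun τ => singularCoords k ζ u v τ 0) (𝓝[>] 0) (𝓝 1) := tendsto_tanh_div
  have hτα := hτ0.mul hα
  have hδ : ∃ δ, Tendsto (fun τ => singularCoords k ζ u v τ 2) (𝓝[>] 0) (𝓝 δ) := by
    refine ⟨_, Tendsto.congr' ?_ ((((tendsto_const_nhds (x := ((k : ℝ) + 1) ^ 2)).sub
      ((((hτα.const_add (2 * (k : ℝ) + 1)).sub
        (hθ.mul ((hτ0.mul hτβ).const_add 1))).pow 2).const_mul (ζ ^ 2))).sub
      (hτγ.pow 2)).add (hτβ.pow 2) |>.const_mul (1 / 2))⟩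
    filter_upwards [self_mem_nhdsWithin] with τ hτ
    have h1 := two_mul_singularCoords_two (hb.energy_eq τ hτ) hτ
    have h2 : 1 / 2 * singularField k ζ τ (singularCoords k ζ u v τ) 2 =
        singularCoords k ζ u v τ 2 := by
      rw [← h1]
      ring
    refine Eq.trans ?_ h2
    simp only [singularField, Matrix.cons_val]
    ring
  obtain ⟨δ, hδ⟩ := hδ
  have hF : ∃ R, Tendsto (fun τ => singularField k ζ τ (singularCoords k ζ u v τ) 3)
      (𝓝[>] 0) (𝓝 R) := by
    have h1 := ((hδ.neg.add (hθ.const_mul (2 * ζ ^ 2 * ((k : ℝ) + 1)))).sub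
      (hτβ.mul (hτγ.sub ((hτ0.mul hθ).const_mul (2 * ζ ^ 2 * ((k : ℝ) + 1)))))).sub
      ((hτα.const_add (2 * (k : ℝ) + 1)).const_mul (2 * ζ ^ 2 * ((k : ℝ) + 1)))
    refine ⟨_, h1.congr fun τ => ?_⟩
    simp only [singularField, Matrix.cons_val]
    ring
  obtain ⟨R, hR⟩ := hF
  have hβ' : Tendsto (fun τ => singularCoords k ζ u v τ 3) (𝓝[>] 0) (𝓝 (R / 3)) := by
    have h1 : Tendsto (fun τ => τ ^ (2 + 1) * singularCoords k ζ u v τ 3 / τ ^ 3) (𝓝[>] 0)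
        (𝓝 (R / 3)) := by
      refine HasDerivAt.lhopital_zero_right_on_Ioo one_pos
        (fun τ hτ => h.hasDerivAt_singularCoords_three hτ.1) (fun τ _ => hasDerivAt_pow 3 τ)
        (fun τ hτ => by have := hτ.1; positivity)
        (tendsto_zero_mul_of_isBigO_one (tendsto_pow_nhdsGT_zero (by norm_num)) hβ)
        (tendsto_pow_nhdsGT_zero (by norm_num)) ?_
      refine (hR.div_const 3).congr' ?_
      filter_upwards [self_mem_nhdsWithin] with τ hτ
      have := ne_of_gt (mem_Ioi.1 hτ)
      push_cast
      field_simp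
    refine h1.congr' ?_
    filter_upwards [self_mem_nhdsWithin] with τ hτ
    have := ne_of_gt (mem_Ioi.1 hτ)
    field_simp
    ring
  have hη : Tendsto (fun τ => singularCoords k ζ u v τ 4) (𝓝[>] 0) (𝓝 2) := by
    have h1 : (fun τ => (Real.exp (u τ) - 2 * τ) * τ⁻¹) =O[𝓝[>] 0] fun τ : ℝ => τ ^ 3 * τ⁻¹ :=
      (hb.exp_u_sub_isBigO h hζ hζ').mul (isBigO_refl _ _)
    have h2 : Tendsto (fun τ : ℝ => τ ^ 3 * τ⁻¹) (𝓝[>] 0) (𝓝 0) := by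
      refine (tendsto_pow_nhdsGT_zero two_ne_zero).congr' ?_
      filter_upwards [self_mem_nhdsWithin] with τ hτ
      have := ne_of_gt (mem_Ioi.1 hτ)
      field_simp
    have h3 := (h1.trans_tendsto h2).const_add 2
    rw [add_zero] at h3
    refine h3.congr' ?_
    filter_upwards [self_mem_nhdsWithin] with τ hτ
    have := ne_of_gt (mem_Ioi.1 hτ)
    simp only [singularCoords, Matrix.cons_val]
    field_simp
    ring
  have hv : Tendsto (fun τ => singularCoords k ζ u v τ 5) (𝓝[>] 0) (𝓝 0) :=
    (hb.v_isBigO hζ hζ').trans_tendsto (tendsto_pow_nhdsGT_zero two_ne_zero)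
  refine ⟨![1, α, δ, R / 3, 2, 0], rfl, rfl, rfl, tendsto_pi_nhds.2 fun i => ?_⟩
  fin_cases i <;> assumption

end SingularLimit

/-! ### Analyticity at the singular point -/

/-- The integral operator on `C([0, 1])⁶` whose fixed points are the solutions of the system at the
singular point with the initial values `x`, rescaled by `r`. The equations `(τ θ)' = F₀` and
`(τ³ β)' = τ² F₃` are integrated with `radialMean`, and the equation for `δ` is algebraic. -/
noncomputable def singularOperator (k : ℕ) (ζ : ℝ) (x : Fin 6 → ℝ)
    (p : ℝ × (Fin 6 → C(unitInterval, ℝ))) : Fin 6 → C(unitInterval, ℝ) :=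
  let F := singularField k (.const _ ζ) (p.1 • coordinate) p.2
  ![radialMean 0 (F 0),
    .const _ (x 1) + p.1 • (coordinate * radialMean 0 (F 1)),
    (1 / 2 : ℝ) • F 2,
    radialMean 2 (F 3),
    .const _ (x 4) + p.1 • (coordinate * radialMean 0 (F 4)),
    .const _ (x 5) + p.1 • (coordinate * radialMean 0 (F 5))]

theorem contDiff_singularOperator (k : ℕ) (ζ : ℝ) (x : Fin 6 → ℝ) :
    ContDiff ℝ ω (singularOperator k ζ x) := by
  have hF : ∀ i, ContDiff ℝ ω fun p : ℝ × (Fin 6 → C(unitInterval, ℝ)) =>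
      singularField k (.const _ ζ) (p.1 • coordinate) p.2 i := by
    intro i
    fin_cases i <;> simp only [singularField] <;> simp <;> fun_prop
  have hK : ∀ n i, ContDiff ℝ ω fun p : ℝ × (Fin 6 → C(unitInterval, ℝ)) =>
      radialMean n (singularField k (.const _ ζ) (p.1 • coordinate) p.2 i) := fun n i =>
    (radialMean n).contDiff.comp (hF i)
  have hP : ∀ i c, ContDiff ℝ ω fun p : ℝ × (Fin 6 → C(unitInterval, ℝ)) =>
      ContinuousMap.const unitInterval c + p.1 • (coordinate *
        radialMean 0 (singularField k (.const _ ζ) (p.1 • coordinate) p.2 i)) := fun i c =>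
    contDiff_const.add (contDiff_fst.smul (contDiff_const.mul (hK 0 i)))
  rw [contDiff_pi]
  intro i
  fin_cases i
  · exact hK 0 0
  · exact hP 1 _
  · exact (hF 2).const_smul (1 / 2 : ℝ)
  · exact hK 2 3
  · exact hP 4 _
  · exact hP 5 _

/-- At `r = 0` the third iterate of the operator is constant: `θ`, `α`, `η`, `v` are constant after
one step, `δ` depends on `θ` only, and `β` depends on `θ` and `δ` only. -/
theorem singularOperator_zero_iterate (k : ℕ) (ζ : ℝ) (x : Fin 6 → ℝ)
    (Y Y' : Fin 6 → C(unitInterval, ℝ)) :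
    singularOperator k ζ x (0, singularOperator k ζ x (0, singularOperator k ζ x (0, Y))) =
      singularOperator k ζ x (0, singularOperator k ζ x (0, singularOperator k ζ x (0, Y'))) := by
  have h0 : ∀ Z Z' : Fin 6 → C(unitInterval, ℝ),
      singularOperator k ζ x (0, Z) 0 = singularOperator k ζ x (0, Z') 0 := by
    intro Z Z'
    simp [singularOperator, singularField]
  have h2 : ∀ Z Z' : Fin 6 → C(unitInterval, ℝ), Z 0 = Z' 0 →
      singularOperator k ζ x (0, Z) 2 = singularOperator k ζ x (0, Z') 2 := by
    intro Z Z' h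
    simp [singularOperator, singularField, h]
  have h3 : ∀ Z Z' : Fin 6 → C(unitInterval, ℝ), Z 0 = Z' 0 → Z 2 = Z' 2 →
      singularOperator k ζ x (0, Z) 3 = singularOperator k ζ x (0, Z') 3 := by
    intro Z Z' h h'
    simp [singularOperator, singularField, h, h']
  have h145 : ∀ Z Z' : Fin 6 → C(unitInterval, ℝ), ∀ i ∈ ({1, 4, 5} : Set (Fin 6)),
      singularOperator k ζ x (0, Z) i = singularOperator k ζ x (0, Z') i := by
    rintro Z Z' i (rfl | rfl | rfl) <;> simp [singularOperator]
  funext i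
  fin_cases i
  · exact h0 _ _
  · exact h145 _ _ 1 (by simp)
  · exact h2 _ _ (h0 _ _)
  · exact h3 _ _ (h0 _ _) (h2 _ _ (h0 _ _))
  · exact h145 _ _ 4 (by simp)
  · exact h145 _ _ 5 (by simp)

/-- Extension of a function on `(0, ∞)` with a limit at `0` to a continuous function on the line. -/
theorem exists_continuousMap_of_tendsto {x : ℝ → ℝ} {L : ℝ} (hx : ∀ τ, 0 < τ → ContinuousAt x τ)
    (hL : Tendsto x (𝓝[>] 0) (𝓝 L)) :
    ∃ X : C(ℝ, ℝ), X 0 = L ∧ ∀ τ, 0 < τ → X τ = x τ := by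
  refine ⟨⟨fun τ => if 0 < τ then x τ else L, continuous_iff_continuousAt.2 fun τ => ?_⟩,
    by simp, fun τ hτ => by simp [hτ]⟩
  rcases lt_trichotomy τ 0 with h | rfl | h
  · refine continuousAt_const.congr (f := fun _ => L) ?_
    filter_upwards [Iio_mem_nhds h] with σ hσ
    rw [if_neg (not_lt.2 (le_of_lt hσ))]
  · rw [ContinuousAt, if_neg (lt_irrefl _), ← nhdsLE_sup_nhdsGT, tendsto_sup]
    constructor
    · refine tendsto_const_nhds.congr' ?_
      filter_upwards [self_mem_nhdsWithin] with σ hσ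
      rw [if_neg (not_lt.2 hσ)]
    · refine hL.congr' ?_
      filter_upwards [self_mem_nhdsWithin] with σ hσ
      rw [if_pos (mem_Ioi.1 hσ)]
  · refine (hx τ h).congr ?_
    filter_upwards [Ioi_mem_nhds h] with σ hσ
    rw [if_pos (mem_Ioi.1 hσ)]

section SingularAnalytic

variable {k : ℕ} {C ζ : ℝ} {u v : ℝ → ℝ}

/-- The regular coordinates extend real-analytically across the singular point. -/
theorem AprioriBounds.exists_analyticAt_singularCoords (h : IsSolution k ζ u v)
    (hb : AprioriBounds k C ζ u v) {x : Fin 6 → ℝ}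
    (hx : Tendsto (singularCoords k ζ u v) (𝓝[>] 0) (𝓝 x)) (i : Fin 6) :
    ∃ w : ℝ → ℝ, AnalyticAt ℝ w 0 ∧ ∀ᶠ τ in 𝓝[>] 0, singularCoords k ζ u v τ i = w τ := by
  choose Z hZ0 hZ using fun i => exists_continuousMap_of_tendsto
    (fun τ hτ => continuousAt_pi.1 (h.continuousAt_singularCoords hτ) i) (tendsto_pi_nhds.1 hx i)
  let R : Fin 6 → C(ℝ, ℝ) := singularField k (.const _ ζ) (.id ℝ) Z
  have hR : ∀ τ, 0 < τ → ∀ i, R i τ = singularField k ζ τ (singularCoords k ζ u v τ) i := by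
    intro τ hτ i
    refine (map_singularField k (ContinuousMap.evalAlgHom ℝ ℝ τ).toRingHom _ _ Z i).trans ?_
    congr 1
    funext j
    exact hZ j τ hτ
  have hres : ∀ r i, singularField k (.const _ ζ) (r • coordinate) (fun i => rescale (Z i) r) i =
      rescale (R i) r := by
    intro r i
    ext t
    refine (map_singularField k (ContinuousMap.evalAlgHom ℝ ℝ t).toRingHom _ _ _ i).trans ?_
    exact (map_singularField k (ContinuousMap.evalAlgHom ℝ ℝ (r * t : ℝ)).toRingHom
      (.const _ ζ) (.id ℝ) Z i).symm
  have hprim : ∀ i, (∀ τ, 0 < τ → HasDerivAt (fun τ => singularCoords k ζ u v τ i)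
      (singularField k ζ τ (singularCoords k ζ u v τ) i) τ) → ∀ r, 0 < r →
      rescale (Z i) r = .const _ (x i) + r • (coordinate * radialMean 0 (rescale (R i) r)) := by
    intro i hi r hr
    rw [← hZ0 i]
    refine rescale_eq_of_hasDerivAt fun τ hτ => ?_
    rw [min_eq_left hr.le, max_eq_right hr.le] at hτ
    rw [hR τ hτ.1]
    refine (hi τ hτ.1).congr_of_eventuallyEq ?_
    filter_upwards [Ioi_mem_nhds hτ.1] with σ hσ using hZ i σ hσ
  have hmean : ∀ i n, (∀ τ, 0 < τ → HasDerivAt (fun τ => τ ^ (n + 1) * singularCoords k ζ u v τ i)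
      (τ ^ n * singularField k ζ τ (singularCoords k ζ u v τ) i) τ) → ∀ r, 0 < r →
      rescale (Z i) r = radialMean n (rescale (R i) r) := by
    intro i n hi r hr
    refine rescale_eq_of_hasDerivAt_pow_mul hr fun τ hτ => ?_
    rw [hR τ hτ.1]
    refine (hi τ hτ.1).congr_of_eventuallyEq ?_
    filter_upwards [Ioi_mem_nhds hτ.1] with σ hσ
    rw [hZ i σ hσ]
  have hfix : ∀ r, 0 < r → (fun i => rescale (Z i) r) =
      singularOperator k ζ x (r, fun i => rescale (Z i) r) := by
    intro r hr
    funext i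
    simp only [singularOperator, hres]
    fin_cases i
    · exact hmean 0 0 (fun τ hτ => hasDerivAt_singularCoords_zero hτ) r hr
    · exact hprim 1 (fun τ hτ => h.hasDerivAt_singularCoords_one hτ) r hr
    · -- the algebraic equation holds for `τ > 0`, and at `τ = 0` by continuity
      have h1 : EqOn (Z 2) (fun τ => 1 / 2 * R 2 τ) (closure (Ioi 0)) := by
        refine EqOn.closure (fun τ (hτ : 0 < τ) => ?_) (Z 2).continuous (by fun_prop)
        rw [hR τ hτ, ← two_mul_singularCoords_two (hb.energy_eq τ hτ) hτ, hZ 2 τ hτ]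
        ring
      rw [closure_Ioi] at h1
      ext t
      exact h1 (mul_nonneg hr.le t.2.1)
    · exact hmean 3 2 (fun τ hτ => h.hasDerivAt_singularCoords_three hτ) r hr
    · exact hprim 4 (fun τ hτ => h.hasDerivAt_singularCoords_four hτ) r hr
    · exact hprim 5 (fun τ hτ => h.hasDerivAt_singularCoords_five hτ) r hr
  have hΦ := contDiff_singularOperator k ζ x
  obtain ⟨g, hg, hgY⟩ := exists_analyticAt_of_fixedPoint
    (Φ := fun p => singularOperator k ζ x
      (p.1, singularOperator k ζ x (p.1, singularOperator k ζ x p)))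
    (hΦ.comp (contDiff_fst.prodMk (hΦ.comp (contDiff_fst.prodMk hΦ))))
    (singularOperator_zero_iterate k ζ x) (nhdsWithin_le_nhds (s := Ioi (0 : ℝ)))
    (((continuous_pi fun i => continuous_rescale (Z i)).tendsto 0).mono_left nhdsWithin_le_nhds)
    (by
      filter_upwards [self_mem_nhdsWithin] with r hr
      rw [← hfix r hr, ← hfix r hr, ← hfix r hr])
  refine ⟨fun r => ContinuousMap.evalCLM ℝ 1 (g r i),
    (ContinuousLinearMap.analyticAt _ _).comp (analyticAt_pi_iff.1 hg i), ?_⟩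
  filter_upwards [hgY, self_mem_nhdsWithin] with τ hτ hτ0
  rw [← hτ]
  change _ = Z i (τ * (1 : unitInterval))
  rw [Set.Icc.coe_one, mul_one, hZ i _ hτ0]

/-- A solution as a curve in the phase space of `field`. -/
noncomputable def phaseCurve (ζ : ℝ) (u v : ℝ → ℝ) (τ : ℝ) : Fin 7 → ℝ :=
  ![u τ, Real.exp (-2 * u τ), deriv u τ, v τ, deriv v τ, Real.tanh τ, ζ]

theorem IsSolution.hasDerivAt_phaseCurve (h : IsSolution k ζ u v) {τ : ℝ} (hτ : 0 < τ) :
    HasDerivAt (phaseCurve ζ u v) (field k (phaseCurve ζ u v τ)) τ := by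
  rw [hasDerivAt_pi]
  intro i
  fin_cases i
  · exact h.hasDerivAt_u hτ
  · exact (h.hasDerivAt_exp_neg_two_u hτ).congr_deriv (by simp [field, phaseCurve]; ring)
  · exact h.eq_u τ hτ
  · exact h.hasDerivAt_v hτ
  · exact h.eq_v τ hτ
  · exact hasDerivAt_tanh τ
  · exact hasDerivAt_const τ ζ

theorem AprioriBounds.isAnalyticPair (hb : AprioriBounds k C ζ u v) (h : IsSolution k ζ u v)
    (hζ : 0 ≤ ζ) (hζ' : ζ < 1 / 2) : IsAnalyticPair u v := by
  obtain ⟨x, -, hx4, -, hx⟩ := hb.exists_tendsto_singularCoords h hζ hζ'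
  have hcurve : ∀ τ, 0 < τ → AnalyticAt ℝ (phaseCurve ζ u v) τ := fun τ hτ =>
    analyticAt_of_hasDerivAt_field (k := k) (eventually_of_mem (Ioi_mem_nhds hτ)
      fun σ hσ => h.hasDerivAt_phaseCurve hσ)
  refine ⟨fun τ hτ => analyticAt_pi_iff.1 (hcurve τ hτ) 0,
    fun τ hτ => analyticAt_pi_iff.1 (hcurve τ hτ) 3, ?_, ?_⟩
  · obtain ⟨w, hw, hwe⟩ := hb.exists_analyticAt_singularCoords h hx 4
    have hw0 : w 0 = 2 := by
      rw [← hx4]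
      exact tendsto_nhds_unique (hw.continuousAt.tendsto.mono_left nhdsWithin_le_nhds)
        ((tendsto_pi_nhds.1 hx 4).congr' hwe)
    refine ⟨fun τ => Real.log (w τ), hw.log (by rw [hw0]; exact two_pos), ?_⟩
    filter_upwards [hwe, self_mem_nhdsWithin] with τ hτ hτ0
    have h0 : (0 : ℝ) < τ := hτ0
    have h1 : Real.exp (u τ) / τ = w τ := hτ
    rw [← h1, Real.log_div (Real.exp_pos _).ne' h0.ne', Real.log_exp]
    ring
  · obtain ⟨w, hw, hwe⟩ := hb.exists_analyticAt_singularCoords h hx 5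
    exact ⟨w, hw, hwe⟩

/-! ### Recovering the asymptotic conditions from the bounds -/

theorem AprioriBounds.tendsto_v_div (hb : AprioriBounds k C ζ u v) (h : IsSolution k ζ u v)
    (hζ : 0 ≤ ζ) (hζ' : ζ < 1 / 2) :
    Tendsto (fun τ => v τ / τ ^ 2) (𝓝[>] 0) (𝓝 (2 * (k : ℝ))) := by
  obtain ⟨x, hx0, hx4, -, hx⟩ := hb.exists_tendsto_singularCoords h hζ hζ'
  have hx' := tendsto_pi_nhds.1 hx
  have hτ0 := tendsto_id_nhdsGT_zero
  have h1 := ((hx' 4).mul (((hτ0.mul (hx' 1)).const_add (2 * (k : ℝ) + 1)).sub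
    ((hx' 0).mul (((hτ0.pow 2).mul (hx' 3)).const_add 1)))).div_const 2
  rw [hx0, hx4] at h1
  refine HasDerivAt.lhopital_zero_right_on_Ioo one_pos
    (fun τ hτ => h.hasDerivAt_singularCoords_five hτ.1) (fun τ _ => hasDerivAt_pow 2 τ)
    (fun τ hτ => by have := hτ.1; positivity)
    ((hb.v_isBigO hζ hζ').trans_tendsto (tendsto_pow_nhdsGT_zero two_ne_zero))
    (tendsto_pow_nhdsGT_zero two_ne_zero) ?_
  convert! h1.congr' ?_ using 2
  · ring
  · filter_upwards [self_mem_nhdsWithin] with τ hτ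
    have := ne_of_gt (mem_Ioi.1 hτ)
    simp only [singularField, Matrix.cons_val]
    push_cast
    field_simp

theorem AprioriBounds.hasAsymptotics (hb : AprioriBounds k C ζ u v) (h : IsSolution k ζ u v)
    (hζ : 0 ≤ ζ) (hζ' : ζ < 1 / 2) : HasAsymptotics k u v := by
  have hk : (0 : ℝ) < k + 1 := by positivity
  refine ⟨?_, ?_, hb.tendsto_v_div h hζ hζ', ?_⟩
  · obtain ⟨w, hw, hwe⟩ := (hb.isAnalyticPair h hζ hζ').analytic_u_zero
    have h1 : w =O[𝓝[>] 0] fun _ : ℝ => (1 : ℝ) :=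
      (hw.continuousAt.tendsto.mono_left nhdsWithin_le_nhds).isBigO_one ℝ
    have h2 : (fun _ : ℝ => (1 : ℝ)) =o[𝓝[>] 0] Real.log :=
      (isLittleO_const_left_of_ne one_ne_zero).2
        (tendsto_abs_atBot_atTop.comp Real.tendsto_log_nhdsGT_zero)
    refine (h1.trans_isLittleO h2).congr' ?_ EventuallyEq.rfl
    filter_upwards [hwe] with τ hτ
    rw [Pi.sub_apply, hτ]
    ring
  · have h1 : Tendsto (fun τ : ℝ => Real.log (2 * τ) / (2 * τ)) atTop (𝓝 0) :=
      (Real.isLittleO_log_id_atTop.tendsto_div_nhds_zero).comp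
        (tendsto_id.const_mul_atTop two_pos)
    rw [isEquivalent_iff_tendsto_one (by
      filter_upwards [eventually_gt_atTop 0] with τ hτ using (mul_pos hk hτ).ne')]
    have h2 : Tendsto (fun τ : ℝ => 1 + (2 / ((k : ℝ) + 1)) * (Real.log (2 * τ) / (2 * τ))) atTop
        (𝓝 1) := by
      simpa using (h1.const_mul (2 / ((k : ℝ) + 1))).const_add 1
    have h3 : Tendsto (fun τ : ℝ => 1 + (u 1 - ((k : ℝ) + 1)) / (((k : ℝ) + 1) * τ)) atTop
        (𝓝 1) := by
      simpa using ((tendsto_const_nhds (x := u 1 - ((k : ℝ) + 1))).div_atTop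
        (tendsto_id.const_mul_atTop hk)).const_add 1
    refine tendsto_of_tendsto_of_tendsto_of_le_of_le' h3 h2 ?_ ?_
    · filter_upwards [eventually_ge_atTop 1] with τ hτ
      have hτ0 : 0 < τ := by linarith
      have hmono : MonotoneOn (fun τ => u τ - ((k : ℝ) + 1) * τ) (Ioi 0) :=
        monotoneOn_of_hasDerivAt_nonneg (convex_Ioi 0) (fun σ hσ => (h.hasDerivAt_u hσ).sub
          ((hasDerivAt_id σ).const_mul ((k : ℝ) + 1)))
          fun σ hσ => by linarith [hb.le_deriv_u σ hσ]
      have h4 := hmono (mem_Ioi.2 one_pos) (mem_Ioi.2 hτ0) hτ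
      simp only [mul_one] at h4
      rw [Pi.div_apply, le_div_iff₀ (mul_pos hk hτ0), add_mul, one_mul,
        div_mul_cancel₀ _ (mul_pos hk hτ0).ne']
      linarith
    · filter_upwards [eventually_gt_atTop 0] with τ hτ
      have h4 := Real.log_le_log (Real.exp_pos _) (hb.exp_u_le τ hτ)
      rw [Real.log_exp, Real.log_mul (by positivity) (Real.exp_pos _).ne', Real.log_exp] at h4
      rw [Pi.div_apply, div_le_iff₀ (mul_pos hk hτ)]
      refine h4.trans_eq ?_
      field_simp
      ring
  · -- a polynomial times `e^{2 ζ (k + 1) τ}` is dominated by a slightly faster exponential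
    have hε : 0 < (1 - 2 * ζ) / 2 := by linarith
    set ε := (1 - 2 * ζ) / 2 with hε_def
    have hcε : 0 < ((k : ℝ) + 1) * ε := mul_pos hk hε
    refine ⟨1, ε, hε, ?_⟩
    have h1 : Tendsto (fun τ : ℝ => C * (τ ^ 2 * Real.exp (-(((k : ℝ) + 1) * ε) * τ) +
        τ ^ 3 * Real.exp (-(((k : ℝ) + 1) * ε) * τ))) atTop (𝓝 (C * (0 + 0))) := by
      have h2 : ∀ n : ℕ, Tendsto (fun τ : ℝ => τ ^ n * Real.exp (-(((k : ℝ) + 1) * ε) * τ)) atTop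
          (𝓝 0) := fun n => by
        have := tendsto_rpow_mul_exp_neg_mul_atTop_nhds_zero (n : ℝ) _ hcε
        simpa using this
      exact ((h2 2).add (h2 3)).const_mul C
    rw [add_zero, mul_zero] at h1
    filter_upwards [h1.eventually (gt_mem_nhds one_pos), eventually_gt_atTop 0] with τ hτ hτ0
    have h3 : Real.exp (2 * ζ * ((k : ℝ) + 1) * τ) =
        Real.exp (-(((k : ℝ) + 1) * ε) * τ) * Real.exp (((k : ℝ) + 1) * (1 - ε) * τ) := by
      rw [← Real.exp_add, hε_def]
      ring_nf
    calc |v τ| ≤ C * (τ ^ 2 + τ ^ 3) * Real.exp (2 * ζ * ((k : ℝ) + 1) * τ) := hb.abs_v_le τ hτ0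
      _ = C * (τ ^ 2 * Real.exp (-(((k : ℝ) + 1) * ε) * τ) +
        τ ^ 3 * Real.exp (-(((k : ℝ) + 1) * ε) * τ)) * Real.exp (((k : ℝ) + 1) * (1 - ε) * τ) := by
          rw [h3]; ring
      _ ≤ _ := by gcongr

end SingularAnalytic

/-! ### Limits of solutions -/

section Limit

variable {k : ℕ} {C : ℝ}

theorem AprioriBounds.of_tendsto {ζ : ℕ → ℝ} {ζbar : ℝ} {u v : ℕ → ℝ → ℝ} {ubar vbar : ℝ → ℝ}
    (hb : ∀ j, AprioriBounds k C (ζ j) (u j) (v j)) (hζ : Tendsto ζ atTop (𝓝 ζbar))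
    (hu : ∀ τ, 0 < τ → Tendsto (fun j => u j τ) atTop (𝓝 (ubar τ)))
    (hv : ∀ τ, 0 < τ → Tendsto (fun j => v j τ) atTop (𝓝 (vbar τ)))
    (hu' : ∀ τ, 0 < τ → Tendsto (fun j => deriv (u j) τ) atTop (𝓝 (deriv ubar τ)))
    (hv' : ∀ τ, 0 < τ → Tendsto (fun j => deriv (v j) τ) atTop (𝓝 (deriv vbar τ))) :
    AprioriBounds k C ζbar ubar vbar := by
  have hV : ∀ τ, 0 < τ → Tendsto (fun j => V k (ζ j) (v j) τ) atTop (𝓝 (V k ζbar vbar τ)) :=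
    fun τ hτ => (((hζ.pow 2).mul_const ((k : ℝ) + 1)).mul (hv τ hτ)).const_sub 1
  have hexp : ∀ τ, 0 < τ → Tendsto (fun j => Real.exp (u j τ)) atTop (𝓝 (Real.exp (ubar τ))) :=
    fun τ hτ => (Real.continuous_exp.tendsto _).comp (hu τ hτ)
  have hexp2 : ∀ τ, Tendsto (fun j => Real.exp (2 * ζ j * ((k : ℝ) + 1) * τ)) atTop
      (𝓝 (Real.exp (2 * ζbar * ((k : ℝ) + 1) * τ))) := fun τ =>
    (Real.continuous_exp.tendsto _).comp (((hζ.const_mul 2).mul_const _).mul_const _)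
  refine ⟨fun τ hτ => ?_, fun τ hτ => ?_, fun τ hτ => ?_, fun τ hτ => ?_, fun τ hτ => ?_,
    fun τ hτ => ?_, fun τ hτ => ?_⟩
  · have h1 : Tendsto (fun j => energy k (ζ j) (u j) (v j) τ) atTop
        (𝓝 (energy k ζbar ubar vbar τ)) :=
      ((hu' τ hτ).pow 2).add (((Real.continuous_exp.tendsto _).comp ((hu τ hτ).const_mul (-2))).mul
        (((hζ.pow 2).mul ((hv' τ hτ).pow 2)).sub (((hV τ hτ).pow 2).const_mul 4)))
    exact tendsto_nhds_unique h1
      (tendsto_const_nhds.congr fun j => ((hb j).energy_eq τ hτ).symm)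
  · exact ge_of_tendsto' (hu' τ hτ) fun j => (hb j).le_deriv_u τ hτ
  · exact le_of_tendsto' (hexp τ hτ) fun j => (hb j).exp_u_le τ hτ
  · exact ge_of_tendsto' (hexp τ hτ) fun j => (hb j).le_exp_u τ hτ
  · exact le_of_tendsto_of_tendsto' (hV τ hτ).abs (hexp2 τ) fun j => (hb j).abs_V_le τ hτ
  · exact le_of_tendsto_of_tendsto' (hv' τ hτ).abs ((hexp2 τ).const_mul _)
      fun j => (hb j).abs_deriv_v_le τ hτ
  · exact le_of_tendsto_of_tendsto' (hv τ hτ).abs ((hexp2 τ).const_mul _)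
      fun j => (hb j).abs_v_le τ hτ

/-- The bounds confine the phase curves to a ball that depends only on the compact interval. -/
theorem exists_norm_phaseCurve_le (k : ℕ) (hC : 0 ≤ C) {a b : ℝ} (ha : 0 < a) (hab : a ≤ b) :
    ∃ R, ∀ (ζ : ℝ) (u v : ℝ → ℝ), 0 ≤ ζ → ζ < 1 / 2 → AprioriBounds k C ζ u v →
      ∀ τ ∈ Icc a b, ‖phaseCurve ζ u v τ‖ ≤ R := by
  have hk : (0 : ℝ) < k + 1 := by positivity
  have hb0 : 0 < b := ha.trans_le hab
  set m := Real.exp (-2 * ((k : ℝ) + 1)) / 2 * min a 1 with hm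
  have hm0 : 0 < m := mul_pos (by positivity) (lt_min ha one_pos)
  set N := Real.exp (((k : ℝ) + 1) * b) with hN
  have hexp : ∀ {ζ τ : ℝ}, 0 ≤ ζ → ζ < 1 / 2 → τ ∈ Icc a b →
      Real.exp (2 * ζ * ((k : ℝ) + 1) * τ) ≤ N := fun hζ hζ' hτ =>
    Real.exp_le_exp.2 ((two_mul_mul_le (k := k) hζ hζ' (ha.trans_le hτ.1)).2.trans
      (mul_le_mul_of_nonneg_left hτ.2 hk.le))
  have hlow : ∀ {ζ τ : ℝ} {u v : ℝ → ℝ}, AprioriBounds k C ζ u v → τ ∈ Icc a b →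
      m ≤ Real.exp (u τ) := fun {ζ τ u v} hbd hτ => by
    refine le_trans ?_ (hbd.le_exp_u τ (ha.trans_le hτ.1))
    have h1 : 1 ≤ Real.exp (((k : ℝ) + 1) * τ) :=
      Real.one_le_exp (mul_nonneg hk.le (ha.le.trans hτ.1))
    have h2 : m ≤ Real.exp (-2 * ((k : ℝ) + 1)) / 2 * min τ 1 := by
      rw [hm]
      gcongr
      exact hτ.1
    exact h2.trans (le_mul_of_one_le_right (hm0.le.trans h2) h1)
  have hcomp : ∀ i : Fin 7, ∃ R, ∀ (ζ : ℝ) (u v : ℝ → ℝ), 0 ≤ ζ → ζ < 1 / 2 →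
      AprioriBounds k C ζ u v → ∀ τ ∈ Icc a b, |phaseCurve ζ u v τ i| ≤ R := by
    intro i
    fin_cases i
    · refine ⟨|Real.log m| + |Real.log (2 * b * N)|, fun ζ u v _ _ hbd τ hτ => ?_⟩
      have h0 := ha.trans_le hτ.1
      have h1 := Real.log_le_log hm0 (hlow hbd hτ)
      have h2 : Real.exp (u τ) ≤ 2 * b * N := (hbd.exp_u_le τ h0).trans (by
        rw [hN]
        gcongr
        · exact hτ.2
        · exact hτ.2)
      have h3 := Real.log_le_log (Real.exp_pos _) h2
      rw [Real.log_exp] at h1 h3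
      change |u τ| ≤ _
      rw [abs_le]
      constructor
      · linarith [neg_abs_le (Real.log m), abs_nonneg (Real.log (2 * b * N))]
      · linarith [le_abs_self (Real.log (2 * b * N)), abs_nonneg (Real.log m)]
    · refine ⟨(m ^ 2)⁻¹, fun ζ u v _ _ hbd τ hτ => ?_⟩
      change |Real.exp (-2 * u τ)| ≤ _
      rw [Real.abs_exp, exp_neg_two_mul_eq]
      have := hlow hbd hτ
      gcongr
    · refine ⟨((k : ℝ) + 1) + 2 * N / m, fun ζ u v hζ hζ' hbd τ hτ => ?_⟩
      have h0 := ha.trans_le hτ.1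
      change |deriv u τ| ≤ _
      rw [abs_of_nonneg (hk.le.trans (hbd.le_deriv_u τ h0))]
      have h1 := exp_u_mul_deriv_u_le (hbd.energy_eq τ h0)
      have h2 := (hbd.abs_V_le τ h0).trans (hexp hζ hζ' hτ)
      have h3 := hlow hbd hτ
      have h4 : N ≤ Real.exp (u τ) * (N / m) := by
        rw [mul_div_assoc', le_div_iff₀ hm0, mul_comm]
        gcongr
      refine le_of_mul_le_mul_left ?_ (Real.exp_pos (u τ))
      calc Real.exp (u τ) * deriv u τ
          ≤ ((k : ℝ) + 1) * Real.exp (u τ) + 2 * |V k ζ v τ| := h1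
        _ ≤ ((k : ℝ) + 1) * Real.exp (u τ) + 2 * (Real.exp (u τ) * (N / m)) := by
          linarith
        _ = _ := by ring
    · refine ⟨C * (b ^ 2 + b ^ 3) * N, fun ζ u v hζ hζ' hbd τ hτ => ?_⟩
      have h0 := ha.trans_le hτ.1
      have h1 := hexp hζ hζ' hτ
      refine (hbd.abs_v_le τ h0).trans ?_
      have := hτ.2
      gcongr
    · refine ⟨C * (b + b ^ 2) * N, fun ζ u v hζ hζ' hbd τ hτ => ?_⟩
      have h0 := ha.trans_le hτ.1
      have h1 := hexp hζ hζ' hτ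
      refine (hbd.abs_deriv_v_le τ h0).trans ?_
      have := hτ.2
      gcongr
    · exact ⟨1, fun ζ u v _ _ _ τ _ => (Real.abs_tanh_lt_one τ).le⟩
    · exact ⟨1 / 2, fun ζ u v hζ hζ' _ τ _ => (abs_of_nonneg hζ).trans_le hζ'.le⟩
  choose R hR using hcomp
  refine ⟨∑ i, |R i|, fun ζ u v hζ hζ' hbd τ hτ => ?_⟩
  rw [pi_norm_le_iff_of_nonneg (Finset.sum_nonneg fun i _ => abs_nonneg (R i))]
  intro i
  exact ((hR i ζ u v hζ hζ' hbd τ hτ).trans (le_abs_self _)).trans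
    (Finset.single_le_sum (f := fun i => |R i|) (fun i _ => abs_nonneg (R i)) (Finset.mem_univ i))

/-- A curve of the polynomial system whose entries satisfy the algebraic relations of
`phaseCurve` comes from a solution. -/
theorem isSolution_of_hasDerivAt_field {ζ : ℝ} {Y : ℝ → Fin 7 → ℝ}
    (hY : ∀ τ, 0 < τ → HasDerivAt Y (field k (Y τ)) τ)
    (h1 : ∀ τ, 0 < τ → Y τ 1 = Real.exp (-2 * Y τ 0)) (h5 : ∀ τ, 0 < τ → Y τ 5 = Real.tanh τ)
    (h6 : ∀ τ, 0 < τ → Y τ 6 = ζ) :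
    IsSolution k ζ (fun τ => Y τ 0) (fun τ => Y τ 3) ∧
      (∀ τ, 0 < τ → deriv (fun τ => Y τ 0) τ = Y τ 2) ∧
      (∀ τ, 0 < τ → deriv (fun τ => Y τ 3) τ = Y τ 4) := by
  have hYi : ∀ i τ, 0 < τ → HasDerivAt (fun τ => Y τ i) (field k (Y τ) i) τ :=
    fun i τ hτ => hasDerivAt_pi.1 (hY τ hτ) i
  have hu : ∀ τ, 0 < τ → deriv (fun τ => Y τ 0) τ = Y τ 2 := fun τ hτ => (hYi 0 τ hτ).deriv
  have hv : ∀ τ, 0 < τ → deriv (fun τ => Y τ 3) τ = Y τ 4 := fun τ hτ => (hYi 3 τ hτ).deriv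
  refine ⟨⟨fun τ hτ => (hYi 0 τ hτ).differentiableAt, fun τ hτ => (hYi 3 τ hτ).differentiableAt,
    fun τ hτ => ?_, fun τ hτ => ?_⟩, hu, hv⟩
  · rw [hv τ hτ]
    refine ((hYi 2 τ hτ).congr_of_eventuallyEq ?_).congr_deriv ?_
    · filter_upwards [Ioi_mem_nhds hτ] with σ hσ using hu σ hσ
    · simp only [field, V, Matrix.cons_val]
      rw [h1 τ hτ, h5 τ hτ, h6 τ hτ]
  · rw [hv τ hτ, hu τ hτ]
    refine ((hYi 4 τ hτ).congr_of_eventuallyEq ?_).congr_deriv ?_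
    · filter_upwards [Ioi_mem_nhds hτ] with σ hσ using hv σ hσ
    · simp only [field, V, Matrix.cons_val]
      rw [h5 τ hτ, h6 τ hτ]

end Limit

end KnotODE

theorem mainTheorem3 (k : ℕ) (ζ : ℕ → ℝ) (ζbar : ℝ)
    (hζ_nonneg : ∀ j, 0 ≤ ζ j) (hζ_mono : Monotone ζ)
    (hζ_lim : Tendsto ζ atTop (𝓝 ζbar)) (hζbar : ζbar < 1 / 2)
    (u v : ℕ → ℝ → ℝ)
    (hsol : ∀ j, KnotODE.IsSolution k (ζ j) (u j) (v j))
    (hasymp : ∀ j, KnotODE.HasAsymptotics k (u j) (v j)) :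
    ∃ (φ : ℕ → ℕ) (ubar vbar : ℝ → ℝ), StrictMono φ ∧
      KnotODE.ConvergesSmoothly (fun j => u (φ j)) ubar ∧
      KnotODE.ConvergesSmoothly (fun j => v (φ j)) vbar ∧
      KnotODE.IsSolution k ζbar ubar vbar ∧
      KnotODE.HasAsymptotics k ubar vbar ∧
      KnotODE.IsAnalyticPair ubar vbar := by
  have hζ' : ∀ j, ζ j < 1 / 2 := fun j => (hζ_mono.ge_of_tendsto hζ_lim j).trans_lt hζbar
  have hζbar0 : 0 ≤ ζbar := ge_of_tendsto' hζ_lim hζ_nonneg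
  have hb := fun j => (hsol j).aprioriBounds (hasymp j) (hζ_nonneg j) (hζ' j)
  have hX : ∀ j τ, 0 < τ → HasDerivAt (KnotODE.phaseCurve (ζ j) (u j) (v j))
      (KnotODE.field k (KnotODE.phaseCurve (ζ j) (u j) (v j) τ)) τ :=
    fun j τ hτ => (hsol j).hasDerivAt_phaseCurve hτ
  obtain ⟨φ, Y, hφ, hconv, hY⟩ := KnotODE.exists_subseq_tendsto_of_hasDerivAt
    (KnotODE.contDiff_field k) hX (fun a b ha hab => by
      obtain ⟨R, hR⟩ := KnotODE.exists_norm_phaseCurve_le k (KnotODE.boundConst_pos k).le ha hab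
      exact ⟨R, fun j => hR _ _ _ (hζ_nonneg j) (hζ' j) (hb j)⟩)
  have hpt : ∀ i τ, 0 < τ → Tendsto
      (fun j => KnotODE.phaseCurve (ζ (φ j)) (u (φ j)) (v (φ j)) τ i) atTop (𝓝 (Y τ i)) :=
    fun i τ hτ => tendsto_pi_nhds.1 ((hconv τ τ hτ).tendsto_at ⟨le_rfl, le_rfl⟩) i
  have hζφ : Tendsto (fun j => ζ (φ j)) atTop (𝓝 ζbar) := hζ_lim.comp hφ.tendsto_atTop
  obtain ⟨hsolY, hu', hv'⟩ := KnotODE.isSolution_of_hasDerivAt_field (ζ := ζbar) hY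
    (fun τ hτ => tendsto_nhds_unique (hpt 1 τ hτ)
      ((Real.continuous_exp.tendsto _).comp ((hpt 0 τ hτ).const_mul (-2))))
    (fun τ hτ => tendsto_nhds_unique (hpt 5 τ hτ) tendsto_const_nhds)
    (fun τ hτ => tendsto_nhds_unique (hpt 6 τ hτ) hζφ)
  have hbY : KnotODE.AprioriBounds k (KnotODE.boundConst k) ζbar (fun τ => Y τ 0)
      (fun τ => Y τ 3) :=
    KnotODE.AprioriBounds.of_tendsto (fun j => hb (φ j)) hζφ (hpt 0) (hpt 3)
      (fun τ hτ => by rw [hu' τ hτ]; exact hpt 2 τ hτ)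
      (fun τ hτ => by rw [hv' τ hτ]; exact hpt 4 τ hτ)
  have hsmooth : ∀ i : Fin 7, KnotODE.ConvergesSmoothly
      (fun j τ => KnotODE.phaseCurve (ζ (φ j)) (u (φ j)) (v (φ j)) τ i) (fun τ => Y τ i) :=
    fun i => KnotODE.convergesSmoothly_comp (KnotODE.contDiff_field k)
      (g := fun x : Fin 7 → ℝ => x i) (by fun_prop) (fun j => hX (φ j)) hY
      (fun j => KnotODE.contDiffOn_of_hasDerivAt_field (hX (φ j)))
      (KnotODE.contDiffOn_of_hasDerivAt_field hY) hconv
  exact ⟨φ, fun τ => Y τ 0, fun τ => Y τ 3, hφ, hsmooth 0, hsmooth 3, hsolY,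
    hbY.hasAsymptotics hsolY hζbar0 hζbar, hbY.isAnalyticPair hsolY hζbar0 hζbar⟩
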